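/- Let $k$ be a field of characteristic zero, $R = k[x_1,\dots,x_n]$ with its standard grading ($\deg x_i = 1$), $\widehat R = k[[x_1,\dots,x_n]]$, and let $\mathscr D = \mathscr D(R,k)$ be the ring of $k$-linear differential operators on $R$, with $\partial_1,\dots,\partial_n \in \mathscr D$ the partial derivatives. Let $M$ be a finitely generated left $\mathscr D$-module that is graded, i.e. there is a direct sum decomposition $M = \bigoplus_{l\in\mathbb Z} M_l$ with $R_d\, M_l \subseteq M_{d+l}$ and $\partial_i M_l \subseteq M_{l-1}$ for all $d \ge 0$, $l\in\mathbb Z$ and $1\le i\le n$. The completion $\widehat M = \widehat R\otimes_R M$ carries the operators $\partial_i(\widehat s\otimes m) = \partial_i(\widehat s)\otimes m + \widehat s\otimes \partial_i m$, which make it a left module over $\mathscr D(\widehat R,k)$. For $N = M$ or $N = \widehat M$, let $H^i_{\mathrm{dR}}(N)$ be the $i$-th cohomology of the de Rham complex $\Omega^\bullet(N)$, where $\Omega^i(N) = \bigoplus_{j_1<\dots<j_i} N\,dx_{j_1}\wedge\dots\wedge dx_{j_i}$ and $d(m\,dx_{j_1}\wedge\dots\wedge dx_{j_i}) = \sum_{s=1}^n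 \partial_s(m)\,dx_s\wedge dx_{j_1}\wedge\dots\wedge dx_{j_i}$. The map $M\to\widehat M$, $m\mapsto 1\otimes m$, commutes with the $\partial_s$ and so induces $k$-linear maps $$\kappa^i\colon H^i_{\mathrm{dR}}(M)\to H^i_{\mathrm{dR}}(\widehat R\otimes_R M)\qquad (i\ge 0).$$ Then: (a) $\kappa^i$ is injective for every $i\ge 0$; (b) for each $i\ge 0$ such that $\dim_k H^i_{\mathrm{dR}}(M)<\infty$, the map $\kappa^i$ is an isomorphism of $k$-vector spaces. -/

import Mathlib

open scoped TensorProduct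

noncomputable section

namespace DMod

/-! ### Rings of differential operators -/

section DiffOp

variable (k A : Type*) [CommRing k] [CommRing A] [Algebra k A]

/-- `k`-linear differential operators of order at most `p` on a commutative `k`-algebra `A`
(Grothendieck's inductive definition): order at most `0` means commuting with multiplication by
every `a : A`, and order at most `p + 1` means that `[P, a]` has order at most `p` for all `a`. -/
def HasOrderLE : ℕ → Module.End k A → Prop
  | 0, P => ∀ a : A, P * Algebra.lmul k A a - Algebra.lmul k A a * P = 0
  | p + 1, P => ∀ a : A, HasOrderLE p (P * Algebra.lmul k A a - Algebra.lmul k A a * P)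

variable {k A}

theorem HasOrderLE.zero (p : ℕ) : HasOrderLE k A p 0 := by
  induction p with
  | zero => intro a; simp
  | succ p ih => intro a; simpa using ih

theorem HasOrderLE.succ {p : ℕ} {P : Module.End k A} (h : HasOrderLE k A p P) :
    HasOrderLE k A (p + 1) P := by
  induction p generalizing P with
  | zero => intro a; rw [h a]; exact HasOrderLE.zero 0
  | succ p ih => intro a; exact ih (h a)

theorem HasOrderLE.mono {p q : ℕ} (hpq : p ≤ q) {P : Module.End k A} (h : HasOrderLE k A p P) :
    HasOrderLE k A q P := by
  induction hpq with
  | refl => exact h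
  | step _ ih => exact ih.succ

theorem HasOrderLE.add {p : ℕ} {P Q : Module.End k A} (hP : HasOrderLE k A p P)
    (hQ : HasOrderLE k A p Q) : HasOrderLE k A p (P + Q) := by
  induction p generalizing P Q with
  | zero =>
    intro a
    rw [add_mul, mul_add, add_sub_add_comm, hP a, hQ a, add_zero]
  | succ p ih =>
    intro a
    rw [add_mul, mul_add, add_sub_add_comm]
    exact ih (hP a) (hQ a)

theorem HasOrderLE.mul {p q : ℕ} {P Q : Module.End k A} (hP : HasOrderLE k A p P)
    (hQ : HasOrderLE k A q Q) : HasOrderLE k A (p + q) (P * Q) := by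
  have key : ∀ (P Q : Module.End k A) (a : A),
      P * Q * Algebra.lmul k A a - Algebra.lmul k A a * (P * Q) =
        P * (Q * Algebra.lmul k A a - Algebra.lmul k A a * Q) +
          (P * Algebra.lmul k A a - Algebra.lmul k A a * P) * Q := by
    intro P Q a
    simp only [mul_sub, sub_mul, mul_assoc]
    abel
  induction hN : p + q generalizing p q P Q with
  | zero =>
    obtain ⟨rfl, rfl⟩ : p = 0 ∧ q = 0 := by omega
    intro a
    rw [key, hP a, hQ a, mul_zero, zero_mul, add_zero]
  | succ N ih =>
    intro a
    rw [key]
    refine HasOrderLE.add ?_ ?_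
    · cases q with
      | zero => rw [hQ a, mul_zero]; exact HasOrderLE.zero N
      | succ q => exact ih hP (hQ a) (by omega)
    · cases p with
      | zero => rw [hP a, zero_mul]; exact HasOrderLE.zero N
      | succ p => exact ih (hP a) hQ (by omega)

theorem HasOrderLE.lmul (a : A) : HasOrderLE k A 0 (Algebra.lmul k A a) := by
  intro b
  rw [← map_mul, ← map_mul, mul_comm, sub_self]

theorem HasOrderLE.derivation (δ : Derivation k A A) :
    HasOrderLE k A 1 (δ : A →ₗ[k] A) := by
  intro a
  have h : (δ : A →ₗ[k] A) * Algebra.lmul k A a - Algebra.lmul k A a * (δ : A →ₗ[k] A) =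
      Algebra.lmul k A (δ a) := by
    ext b
    simp [mul_comm]
  rw [h]
  exact HasOrderLE.lmul _

variable (k A)

/-- The ring `𝒟(A, k)` of `k`-linear differential operators on `A`. -/
def DiffOp : Subalgebra k (Module.End k A) where
  carrier := {P | ∃ p, HasOrderLE k A p P}
  mul_mem' := fun ⟨p, hP⟩ ⟨q, hQ⟩ => ⟨p + q, hP.mul hQ⟩
  add_mem' := fun ⟨p, hP⟩ ⟨q, hQ⟩ =>
    ⟨max p q, (hP.mono (le_max_left p q)).add (hQ.mono (le_max_right p q))⟩
  algebraMap_mem' c := ⟨0, by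
    have h : algebraMap k (Module.End k A) c = Algebra.lmul k A (algebraMap k A c) := by
      ext b
      simp [Algebra.smul_def]
    rw [h]
    exact HasOrderLE.lmul _⟩

/-- The inclusion `A → 𝒟(A, k)`, sending `a` to multiplication by `a`. -/
def mulOp : A →ₐ[k] DiffOp k A :=
  (Algebra.lmul k A).codRestrict (DiffOp k A) fun a => ⟨0, HasOrderLE.lmul a⟩

variable {k A}

/-- A derivation, as an element of the ring of differential operators. -/
def derivOp (δ : Derivation k A A) : DiffOp k A :=
  ⟨(δ : A →ₗ[k] A), 1, HasOrderLE.derivation δ⟩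

theorem derivOp_mul_mulOp (δ : Derivation k A A) (a : A) :
    derivOp δ * mulOp k A a = mulOp k A a * derivOp δ + mulOp k A (δ a) := by
  apply Subtype.ext
  refine LinearMap.ext fun b => ?_
  change δ (a * b) = a * δ b + δ a * b
  simp [mul_comm]

theorem derivOp_comm {δ ε : Derivation k A A} (h : ∀ a, δ (ε a) = ε (δ a)) :
    derivOp δ * derivOp ε = derivOp ε * derivOp δ :=
  Subtype.ext (LinearMap.ext h)

end DiffOp

/-! ### Modules with commuting operators `∂₁, …, ∂ₙ`, and their de Rham cohomology -/

/-- Commuting `k`-linear operators `∂₁, …, ∂ₙ` on an `A`-module `N` that satisfy the Leibniz rule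
with respect to given `k`-derivations `δ₁, …, δₙ` of `A`. For `A = k[x₁, …, xₙ]` or
`A = k[[x₁, …, xₙ]]`, `k` a field of characteristic zero and `δᵢ` the partial derivatives, this is
the same as a left `𝒟(A, k)`-module structure extending the `A`-module structure. -/
structure Connection {k A : Type*} [CommRing k] [CommRing A] [Algebra k A] {n : ℕ}
    (δ : Fin n → Derivation k A A) (N : Type*) [AddCommGroup N] [Module k N] [Module A N] where
  op : Fin n → Module.End k N
  leibniz : ∀ i (a : A) (m : N), op i (a • m) = a • op i m + δ i a • m
  comm : ∀ i j m, op i (op j m) = op j (op i m)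

/-- `Ωⁱ(N)`: the direct sum of copies `N dx_{j₁} ∧ ⋯ ∧ dx_{jᵢ}` of `N` over all
`j₁ < ⋯ < jᵢ`, the indices being recorded as the set `{j₁, …, jᵢ}`. -/
abbrev Form (n : ℕ) (N : Type*) (i : ℕ) : Type _ :=
  {S : Finset (Fin n) // S.card = i} → N

/-- The sign with `dx_s ∧ dx_{T ∖ s} = wedgeSign s T • dx_T`, for `s ∈ T`: it is `(-1)` to the
number of elements of `T` that `s` has to be moved past. -/
def wedgeSign {n : ℕ} (s : Fin n) (T : Finset (Fin n)) : ℤ :=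
  (-1) ^ (T.filter (· < s)).card

section DeRham

variable {k A : Type*} [CommRing k] [CommRing A] [Algebra k A] {n : ℕ}
  {δ : Fin n → Derivation k A A}
  {N : Type*} [AddCommGroup N] [Module k N] [Module A N]

/-- The de Rham differential `m dx_S ↦ ∑ₛ ∂ₛ m dxₛ ∧ dx_S`, written out in coordinates: the
coefficient of `dx_T` in `d ω` is `∑_{s ∈ T} ± ∂ₛ ω_{T ∖ s}`. -/
def Connection.d (D : Connection δ N) (i : ℕ) : Form n N i →ₗ[k] Form n N (i + 1) where
  toFun ω T := ∑ s : T.1, wedgeSign s.1 T.1 •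
    D.op s.1 (ω ⟨T.1.erase s.1, by rw [Finset.card_erase_of_mem s.2, T.2]; rfl⟩)
  map_add' ω η := by
    funext T
    simp [smul_add, Finset.sum_add_distrib]
  map_smul' c ω := by
    funext T
    simp [Finset.smul_sum, smul_comm c]

theorem wedgeSign_swap {s t : Fin n} {T : Finset (Fin n)} (hs : s ∈ T) (ht : t ∈ T)
    (hst : s ≠ t) :
    wedgeSign t T * wedgeSign s (T.erase t) = -(wedgeSign s T * wedgeSign t (T.erase s)) := by
  wlog h : s < t generalizing s t with H
  · rw [H ht hs hst.symm (lt_of_le_of_ne (not_lt.mp h) hst.symm), neg_neg]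
  have h1 : (T.erase t).filter (· < s) = T.filter (· < s) := by
    ext x
    simp only [Finset.mem_filter, Finset.mem_erase]
    exact ⟨fun hx => ⟨hx.1.2, hx.2⟩, fun hx => ⟨⟨(hx.2.trans h).ne, hx.1⟩, hx.2⟩⟩
  have h2 : (T.erase s).filter (· < t) = (T.filter (· < t)).erase s := by
    ext x
    simp only [Finset.mem_filter, Finset.mem_erase, and_assoc]
  have h3 : (T.filter (· < t)).card = ((T.filter (· < t)).erase s).card + 1 :=
    (Finset.card_erase_add_one (Finset.mem_filter.mpr ⟨hs, h⟩)).symm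
  simp only [wedgeSign, h1, h2, h3, pow_succ]
  ring

theorem Connection.d_d (D : Connection δ N) (i : ℕ) (ω : Form n N i) :
    D.d (i + 1) (D.d i ω) = 0 := by
  funext T
  simp only [Connection.d, LinearMap.coe_mk, AddHom.coe_mk, map_sum, map_zsmul, Finset.smul_sum,
    smul_smul, Pi.zero_apply]
  rw [Finset.sum_sigma']
  refine Finset.sum_involution
    (fun p _ => ⟨⟨p.2.1, Finset.mem_of_mem_erase p.2.2⟩,
      ⟨p.1.1, Finset.mem_erase.mpr ⟨(Finset.ne_of_mem_erase p.2.2).symm, p.1.2⟩⟩⟩)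
    ?_ ?_ (fun _ _ => Finset.mem_sigma.mpr ⟨Finset.mem_univ _, Finset.mem_univ _⟩)
    (fun _ _ => rfl)
  · rintro ⟨⟨s, hs⟩, ⟨t, ht⟩⟩ -
    have hts : t ≠ s := Finset.ne_of_mem_erase ht
    simp only
    rw [wedgeSign_swap (Finset.mem_of_mem_erase ht) hs hts, D.comm s t, neg_smul]
    have h : (T.1.erase s).erase t = (T.1.erase t).erase s := Finset.erase_right_comm
    simp only [h]
    exact neg_add_cancel _
  · rintro ⟨⟨s, hs⟩, ⟨t, ht⟩⟩ - - h
    exact Finset.ne_of_mem_erase ht (congrArg (fun p => p.1.1) h)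

/-- The image of `d^{i-1}` in `Ωⁱ(N)` (zero for `i = 0`). -/
def Connection.coboundaries (D : Connection δ N) : (i : ℕ) → Submodule k (Form n N i)
  | 0 => ⊥
  | i + 1 => LinearMap.range (D.d i)

/-- The kernel of `d^i` in `Ωⁱ(N)`. -/
def Connection.cocycles (D : Connection δ N) (i : ℕ) : Submodule k (Form n N i) :=
  LinearMap.ker (D.d i)

/-- `Hⁱ_dR(N) = ker d^i / im d^{i-1}`. -/
abbrev Connection.Cohomology (D : Connection δ N) (i : ℕ) : Type _ :=
  D.cocycles i ⧸ (D.coboundaries i).submoduleOf (D.cocycles i)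

variable {B : Type*} [CommRing B] [Algebra k B] {ε : Fin n → Derivation k B B}
  {N' : Type*} [AddCommGroup N'] [Module k N'] [Module B N']

theorem Connection.d_comp (D : Connection δ N) (E : Connection ε N') (f : N →ₗ[k] N')
    (hf : ∀ s m, f (D.op s m) = E.op s (f m)) (i : ℕ) (ω : Form n N i) :
    E.d i (f ∘ ω) = f ∘ D.d i ω := by
  funext T
  simp [Connection.d, hf]

theorem Connection.comp_mem_cocycles (D : Connection δ N) (E : Connection ε N') (f : N →ₗ[k] N')
    (hf : ∀ s m, f (D.op s m) = E.op s (f m)) (i : ℕ) :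
    ∀ ω ∈ D.cocycles i, f.compLeft _ ω ∈ E.cocycles i := by
  intro ω hω
  have h : D.d i ω = 0 := hω
  change E.d i (f ∘ ω) = 0
  rw [D.d_comp E f hf, h]
  funext T
  simp

theorem Connection.comp_mem_coboundaries (D : Connection δ N) (E : Connection ε N')
    (f : N →ₗ[k] N') (hf : ∀ s m, f (D.op s m) = E.op s (f m)) (i : ℕ) :
    ∀ ω ∈ D.coboundaries i, f.compLeft _ ω ∈ E.coboundaries i := by
  intro ω hω
  cases i with
  | zero =>
    have h : ω = 0 := hω
    rw [h, map_zero]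
    exact Submodule.zero_mem _
  | succ i =>
    obtain ⟨η, rfl⟩ := hω
    exact ⟨f ∘ η, D.d_comp E f hf i η⟩

/-- The map on de Rham cohomology induced by applying, to every coefficient, a `k`-linear map `f`
that commutes with the operators `∂ₛ`. -/
def Connection.cohomologyMap (D : Connection δ N) (E : Connection ε N') (f : N →ₗ[k] N')
    (hf : ∀ s m, f (D.op s m) = E.op s (f m)) (i : ℕ) :
    D.Cohomology i →ₗ[k] E.Cohomology i :=
  Submodule.mapQ _ _ ((f.compLeft _).restrict (D.comp_mem_cocycles E f hf i))
    fun ω hω => D.comp_mem_coboundaries E f hf i ω.1 hω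

end DeRham

/-! ### `𝒟`-modules over the polynomial ring and their completions -/

section Poly

variable (n : ℕ) (k : Type*) [Field k]

/-- `R = k[x₁, …, xₙ]`. -/
abbrev Poly : Type _ := MvPolynomial (Fin n) k

/-- `R̂ = k[[x₁, …, xₙ]]`. -/
abbrev PSer : Type _ := MvPowerSeries (Fin n) k

/-- `𝒟 = 𝒟(R, k)`. -/
abbrev Diff : Type _ := DiffOp k (Poly n k)

/-- `𝒟` as a left `R`-module. -/
instance instModulePolyDiff : Module (Poly n k) (Diff n k) :=
  Module.compHom _ (mulOp k (Poly n k)).toRingHom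

variable {n}

/-- The element `∂ᵢ` of `𝒟`. -/
def del (i : Fin n) : Diff n k := derivOp (MvPolynomial.pderiv i)

variable {k}

theorem Poly.pderiv_comm (i j : Fin n) (f : Poly n k) :
    MvPolynomial.pderiv i (MvPolynomial.pderiv j f) =
      MvPolynomial.pderiv j (MvPolynomial.pderiv i f) := by
  have h : ⁅MvPolynomial.pderiv (R := k) i, MvPolynomial.pderiv (R := k) j⁆ = 0 := by
    refine MvPolynomial.derivation_ext fun l => ?_
    classical
    simp [Derivation.commutator_apply, MvPolynomial.pderiv_X, Pi.single_apply, apply_ite]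
  have := congrArg (fun D => D f) h
  simpa [Derivation.commutator_apply, sub_eq_zero] using this

theorem PSer.pderiv_comm (i j : Fin n) (f : PSer n k) :
    MvPowerSeries.pderiv k i (MvPowerSeries.pderiv k j f) =
      MvPowerSeries.pderiv k j (MvPowerSeries.pderiv k i f) := by
  rcases eq_or_ne i j with rfl | hij
  · rfl
  ext d
  simp only [MvPowerSeries.coeff_pderiv, Finsupp.add_apply, Finsupp.single_eq_of_ne hij,
    Finsupp.single_eq_of_ne hij.symm, add_zero]
  rw [add_right_comm]
  ring

variable (n k)
variable (M : Type*) [AddCommGroup M] [Module (Poly n k) M]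
  [Module (Diff n k) M] [IsScalarTower (Poly n k) (Diff n k) M]

theorem mulOp_smul (f : Poly n k) (m : M) : mulOp k (Poly n k) f • m = f • m := by
  have h : mulOp k (Poly n k) f = f • (1 : Diff n k) := (mul_one _).symm
  rw [h, smul_assoc, one_smul]

variable [Module k M] [IsScalarTower k (Poly n k) M]

/-- The operators `m ↦ ∂ᵢ • m` on a left `𝒟`-module `M`. -/
def conn : Connection (fun i : Fin n => MvPolynomial.pderiv (R := k) i) M where
  op i :=
    { toFun m := del k i • m
      map_add' := smul_add _
      map_smul' c m := by
        simp only [RingHom.id_apply]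
        rw [← algebraMap_smul (Poly n k) c m, ← algebraMap_smul (Poly n k) c (del k i • m),
          ← mulOp_smul, ← mulOp_smul, smul_smul, smul_smul, del, derivOp_mul_mulOp]
        simp }
  leibniz i f m := by
    change del k i • f • m = f • del k i • m + MvPolynomial.pderiv i f • m
    rw [← mulOp_smul, ← mulOp_smul, ← mulOp_smul, smul_smul, smul_smul, ← add_smul, del,
      derivOp_mul_mulOp]
  comm i j m := by
    change del k i • del k j • m = del k j • del k i • m
    rw [smul_smul, smul_smul, del, del, derivOp_comm (Poly.pderiv_comm i j)]

/-- The completion `M̂ = R̂ ⊗_R M`. -/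
abbrev Completion : Type _ := PSer n k ⊗[Poly n k] M

/-- `∂ᵢ (s ⊗ m) = ∂ᵢ(s) ⊗ m + s ⊗ ∂ᵢ m`, as an additive map on `M̂`. -/
def completionOpAux (i : Fin n) : Completion n k M →+ Completion n k M :=
  TensorProduct.liftAddHom
    { toFun s :=
        { toFun m := MvPowerSeries.pderiv k i s ⊗ₜ m + s ⊗ₜ (conn n k M).op i m
          map_zero' := by simp
          map_add' a b := by simp only [map_add, TensorProduct.tmul_add]; abel }
      map_zero' := by ext; simp
      map_add' s t := by
        ext m
        simp only [map_add, TensorProduct.add_tmul, AddMonoidHom.coe_mk, ZeroHom.coe_mk,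
          AddMonoidHom.add_apply]
        abel }
    (by
      intro f s m
      change MvPowerSeries.pderiv k i (f • s) ⊗ₜ m + (f • s) ⊗ₜ (conn n k M).op i m =
        MvPowerSeries.pderiv k i s ⊗ₜ (f • m) + s ⊗ₜ (conn n k M).op i (f • m)
      have h : MvPowerSeries.pderiv k i (f • s) =
          f • MvPowerSeries.pderiv k i s + MvPolynomial.pderiv i f • s := by
        rw [Algebra.smul_def, Algebra.smul_def, Algebra.smul_def,
          MvPowerSeries.algebraMap_apply', MvPowerSeries.algebraMap_apply']
        simp [MvPowerSeries.pderiv_coe, mul_comm, add_comm]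
      rw [h, (conn n k M).leibniz, TensorProduct.add_tmul, TensorProduct.tmul_add,
        TensorProduct.smul_tmul, TensorProduct.smul_tmul, TensorProduct.smul_tmul]
      abel)

theorem completionOpAux_tmul (i : Fin n) (s : PSer n k) (m : M) :
    completionOpAux n k M i (s ⊗ₜ m) =
      MvPowerSeries.pderiv k i s ⊗ₜ m + s ⊗ₜ (conn n k M).op i m := rfl

theorem completionOpAux_smul (i : Fin n) (a : PSer n k) (x : Completion n k M) :
    completionOpAux n k M i (a • x) =
      a • completionOpAux n k M i x + MvPowerSeries.pderiv k i a • x := by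
  induction x using TensorProduct.induction_on with
  | zero => simp
  | tmul s m =>
    rw [TensorProduct.smul_tmul', completionOpAux_tmul, completionOpAux_tmul, smul_add,
      TensorProduct.smul_tmul', TensorProduct.smul_tmul', TensorProduct.smul_tmul',
      smul_eq_mul, Derivation.leibniz, TensorProduct.add_tmul, smul_eq_mul, smul_eq_mul,
      smul_eq_mul, mul_comm s]
    abel
  | add x y hx hy => simp only [smul_add, map_add, hx, hy]; abel

/-- The operators `∂ᵢ` on `M̂ = R̂ ⊗_R M`, determined by
`∂ᵢ (s ⊗ m) = ∂ᵢ(s) ⊗ m + s ⊗ ∂ᵢ m`. -/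
def completionConn :
    Connection (fun i : Fin n => MvPowerSeries.pderiv k i) (Completion n k M) where
  op i :=
    { toFun := completionOpAux n k M i
      map_add' := map_add _
      map_smul' c x := by
        rw [← algebraMap_smul (PSer n k) c x, completionOpAux_smul, Derivation.map_algebraMap,
          zero_smul, add_zero, algebraMap_smul]
        rfl }
  leibniz i a x := completionOpAux_smul n k M i a x
  comm i j x := by
    change completionOpAux n k M i (completionOpAux n k M j x) =
      completionOpAux n k M j (completionOpAux n k M i x)
    induction x using TensorProduct.induction_on with
    | zero => simp
    | tmul s m =>
      simp only [completionOpAux_tmul, map_add]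
      rw [PSer.pderiv_comm i j, (conn n k M).comm i j]
      abel
    | add x y hx hy => simp only [map_add, hx, hy]

/-- The natural map `κ : M → R̂ ⊗_R M`, `m ↦ 1 ⊗ m`. -/
def kappa : M →ₗ[k] Completion n k M where
  toFun m := 1 ⊗ₜ m
  map_add' := TensorProduct.tmul_add _
  map_smul' c m := by
    simp only [RingHom.id_apply]
    rw [← algebraMap_smul (Poly n k) c m, TensorProduct.tmul_smul, algebraMap_smul]

theorem kappa_op (i : Fin n) (m : M) :
    kappa n k M ((conn n k M).op i m) = (completionConn n k M).op i (kappa n k M m) := by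
  change (1 : PSer n k) ⊗ₜ (conn n k M).op i m = completionOpAux n k M i (1 ⊗ₜ m)
  rw [completionOpAux_tmul]
  simp

/-- The de Rham cohomology `Hⁱ_dR(M)` of a left `𝒟`-module `M`. -/
abbrev HdR (i : ℕ) : Type _ := (conn n k M).Cohomology i

/-- The de Rham cohomology `Hⁱ_dR(R̂ ⊗_R M)` of the completion of a left `𝒟`-module `M`. -/
abbrev HdRCompletion (i : ℕ) : Type _ := (completionConn n k M).Cohomology i

/-- The completion map `κⁱ : Hⁱ_dR(M) → Hⁱ_dR(R̂ ⊗_R M)`, induced by `m ↦ 1 ⊗ m`. -/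
def kappaH (i : ℕ) : HdR n k M i →ₗ[k] HdRCompletion n k M i :=
  (conn n k M).cohomologyMap (completionConn n k M) (kappa n k M) (kappa_op n k M) i

variable {M}

/-- `M = ⨁_{l ∈ ℤ} 𝓜 l` is a grading making `M` a graded `𝒟`-module: `R_d 𝓜_l ⊆ 𝓜_{d + l}` for the
standard grading of `R`, and `∂ᵢ 𝓜_l ⊆ 𝓜_{l - 1}`. -/
structure IsGrading (𝓜 : ℤ → Submodule k M) : Prop where
  isInternal : DirectSum.IsInternal 𝓜
  smul_mem : ∀ (d : ℕ) (l : ℤ) (f : Poly n k) (m : M),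
    f ∈ MvPolynomial.homogeneousSubmodule (Fin n) k d → m ∈ 𝓜 l → f • m ∈ 𝓜 (d + l)
  del_smul_mem : ∀ (i : Fin n) (l : ℤ) (m : M), m ∈ 𝓜 l → del k i • m ∈ 𝓜 (l - 1)

end Poly

end DMod

end

/-!
Every element of `M̂ = R̂ ⊗_R M` has homogeneous components in `M`, which determine it and which it
shares with `m` if it is `1 ⊗ m`; taking components commutes with the `∂ₛ` up to a shift of the
degree. So if `1 ⊗ ω` is exact, then so are the finitely many components of `ω`, and `κⁱ` is
injective. If `dim Hⁱ_dR(M) < ∞`, then `Hⁱ_dR(M)` vanishes in almost all degrees, so that, up to the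
class of a finite sum of its components, a cocycle `ω` over `M̂` has exact components only.

It remains to see that such an `ω` is exact, that is, that primitives of its components can be
assembled to a form over `M̂`. This works as soon as the primitives lie in one finitely generated
`R`-module. Filter `M` by order. The Koszul homology of the associated graded `R[ξ]`-module is
finitely generated and killed by `ξ`, hence vanishes in high order; so an exact form in a given step
of the filtration has a primitive in a step that depends on the given step only. Finally, all
components of an element of `M̂` lie in one finitely generated `R`-module, hence in one such step.
-/

noncomputable section

namespace DMod

section Commutator

variable (k : Type*) {B : Type*} [CommRing k] [Ring B] [Algebra k B]

/-- The commutator `P ↦ [P, x]`, as a linear map. -/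
def adRight (x : B) : B →ₗ[k] B := LinearMap.mulRight k x - LinearMap.mulLeft k x

theorem adRight_apply (x P : B) : adRight k x P = P * x - x * P := rfl

theorem adRight_add (x y P : B) : adRight k (x + y) P = adRight k x P + adRight k y P := by
  simp only [adRight_apply, mul_add, add_mul, add_sub_add_comm]

theorem adRight_mul (x y P : B) : adRight k (x * y) P = adRight k x P * y + x * adRight k y P := by
  simp only [adRight_apply, sub_mul, mul_sub, mul_assoc, sub_add_sub_cancel]

theorem adRight_apply_mul (x P Q : B) :
    adRight k x (P * Q) = adRight k x P * Q + P * adRight k x Q := by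
  simp only [adRight_apply, sub_mul, mul_sub, mul_assoc]
  abel

theorem adRight_adRight_comm {x y : B} (h : Commute x y) (P : B) :
    adRight k x (adRight k y P) = adRight k y (adRight k x P) := by
  simp only [adRight_apply, sub_mul, mul_sub, mul_assoc, h.eq]
  simp only [← mul_assoc, h.eq]
  abel

theorem adRight_algebraMap (c : k) (P : B) : adRight k (algebraMap k B c) P = 0 :=
  sub_eq_zero.2 (Algebra.commutes c P).symm

end Commutator

section Weyl

open MvPolynomial

variable {k σ : Type*} [Field k]

/-- Multiplication by `xᵢ` on `k[x]`. -/
def lmulX (k : Type*) {σ : Type*} [Field k] (i : σ) : Module.End k (MvPolynomial σ k) :=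
  Algebra.lmul k _ (X i)

theorem lmulX_commute (i j : σ) : Commute (lmulX k i) (lmulX k j) :=
  (Commute.all (X i) (X j)).map (Algebra.lmul k (MvPolynomial σ k))

theorem adRight_lmulX_pderiv [DecidableEq σ] (i j : σ) :
    adRight k (lmulX k j) (pderiv i).toLinearMap = if i = j then 1 else 0 := by
  refine LinearMap.ext fun f => ?_
  change pderiv i (X j * f) - X j * pderiv i f = _
  rw [Derivation.leibniz, smul_eq_mul, smul_eq_mul, add_sub_cancel_left, pderiv_X]
  split_ifs with h
  · rw [h, Pi.single_eq_same, mul_one, Module.End.one_apply]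
  · rw [Pi.single_eq_of_ne (Ne.symm h), mul_zero, LinearMap.zero_apply]

theorem adRight_lmul_C (c : k) (P : Module.End k (MvPolynomial σ k)) :
    adRight k (Algebra.lmul k _ (C c)) P = 0 := by
  rw [show Algebra.lmul k _ (C c) = algebraMap k _ c from AlgHom.commutes _ c, adRight_algebraMap]

variable {P : Module.End k (MvPolynomial σ k)}

theorem hasOrderLE_zero_of_adRight_lmulX (h : ∀ i, adRight k (lmulX k i) P = 0) :
    HasOrderLE k (MvPolynomial σ k) 0 P := by
  intro f
  change adRight k (Algebra.lmul k _ f) P = 0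
  induction f using MvPolynomial.induction_on with
  | C c => exact adRight_lmul_C c P
  | add f g hf hg => rw [map_add, adRight_add, hf, hg, add_zero]
  | mul_X f i hf => rw [map_mul, adRight_mul, hf, ← lmulX, h i, zero_mul, mul_zero, add_zero]

theorem hasOrderLE_succ_of_adRight_lmulX {p : ℕ}
    (h : ∀ i, HasOrderLE k (MvPolynomial σ k) p (adRight k (lmulX k i) P)) :
    HasOrderLE k (MvPolynomial σ k) (p + 1) P := by
  intro f
  change HasOrderLE k _ p (adRight k (Algebra.lmul k _ f) P)
  induction f using MvPolynomial.induction_on with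
  | C c =>
    rw [adRight_lmul_C]
    exact HasOrderLE.zero p
  | add f g hf hg =>
    rw [map_add, adRight_add]
    exact hf.add hg
  | mul_X f i hf =>
    rw [map_mul, adRight_mul]
    exact (hf.mul (HasOrderLE.lmul _)).add (((HasOrderLE.lmul f).mul (h i)).mono (zero_add p).le)

section OrderEuler

variable [Fintype σ]

/-- The operator `P ↦ ∑ᵢ [P, xᵢ] ∂ᵢ`. It acts on symbols as the Euler operator `∑ᵢ ξᵢ ∂/∂ξᵢ`, so
it multiplies a differential operator of order `p` by `p` up to terms of lower order. -/
def orderEuler (k σ : Type*) [Field k] [Fintype σ] :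
    Module.End k (MvPolynomial σ k) →ₗ[k] Module.End k (MvPolynomial σ k) :=
  ∑ i, LinearMap.mulRight k (pderiv i).toLinearMap ∘ₗ adRight k (lmulX k i)

theorem orderEuler_apply (P : Module.End k (MvPolynomial σ k)) :
    orderEuler k σ P = ∑ i, adRight k (lmulX k i) P * (pderiv i).toLinearMap := by
  rw [orderEuler, LinearMap.sum_apply]
  rfl

theorem orderEuler_eq_zero (hP : HasOrderLE k (MvPolynomial σ k) 0 P) :
    orderEuler k σ P = 0 := by
  rw [orderEuler_apply]
  exact Finset.sum_eq_zero fun i _ => (congrArg (· * _) (hP (X i))).trans (zero_mul _)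

theorem adRight_lmulX_orderEuler (P : Module.End k (MvPolynomial σ k)) (j : σ) :
    adRight k (lmulX k j) (orderEuler k σ P) =
      orderEuler k σ (adRight k (lmulX k j) P) + adRight k (lmulX k j) P := by
  classical
  simp only [orderEuler_apply, map_sum, adRight_apply_mul, adRight_lmulX_pderiv, mul_ite, mul_one,
    mul_zero, Finset.sum_add_distrib, Finset.sum_ite_eq', Finset.mem_univ, if_true,
    adRight_adRight_comm k (lmulX_commute j _)]

theorem adRight_lmulX_orderEuler_sub (p : ℕ) (P : Module.End k (MvPolynomial σ k)) (j : σ) :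
    adRight k (lmulX k j) (orderEuler k σ P - (p + 1) • P) =
      orderEuler k σ (adRight k (lmulX k j) P) - p • adRight k (lmulX k j) P := by
  rw [map_sub, map_nsmul, adRight_lmulX_orderEuler, succ_nsmul]
  abel

theorem hasOrderLE_orderEuler_sub {p : ℕ} (hP : HasOrderLE k (MvPolynomial σ k) (p + 1) P) :
    HasOrderLE k (MvPolynomial σ k) p (orderEuler k σ P - (p + 1) • P) := by
  induction p generalizing P with
  | zero =>
    refine hasOrderLE_zero_of_adRight_lmulX fun j => ?_
    rw [adRight_lmulX_orderEuler_sub, zero_nsmul, sub_zero]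
    exact orderEuler_eq_zero (hP (X j))
  | succ p ih =>
    refine hasOrderLE_succ_of_adRight_lmulX fun j => ?_
    rw [adRight_lmulX_orderEuler_sub]
    exact ih (hP (X j))

end OrderEuler

/-- The subalgebra of `End k[x]` generated by multiplications and partial derivatives. -/
def weylAlgebra (k σ : Type*) [Field k] : Subalgebra k (Module.End k (MvPolynomial σ k)) :=
  Algebra.adjoin k (Set.range (Algebra.lmul k (MvPolynomial σ k)) ∪
    Set.range fun i => (pderiv i).toLinearMap)

theorem HasOrderLE.mem_weylAlgebra [Finite σ] [CharZero k] {p : ℕ}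
    (hP : HasOrderLE k (MvPolynomial σ k) p P) : P ∈ weylAlgebra k σ := by
  cases nonempty_fintype σ
  induction p generalizing P with
  | zero =>
    refine Algebra.subset_adjoin (Or.inl ⟨P 1, LinearMap.ext fun f => ?_⟩)
    have h : P (f * 1) = f * P 1 := LinearMap.congr_fun (sub_eq_zero.1 (hP f)) 1
    rw [mul_one, mul_comm] at h
    exact h.symm
  | succ p ih =>
    have hsum : orderEuler k σ P ∈ weylAlgebra k σ := by
      rw [orderEuler_apply]
      exact sum_mem fun i _ => mul_mem (ih (hP (X i))) (Algebra.subset_adjoin (Or.inr ⟨i, rfl⟩))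
    have hsmul := sub_mem hsum (ih (hasOrderLE_orderEuler_sub hP))
    rw [sub_sub_cancel, ← Nat.cast_smul_eq_nsmul k, ← Subalgebra.mem_toSubmodule] at hsmul
    exact (Submodule.smul_mem_iff _ (Nat.cast_ne_zero.2 p.succ_ne_zero)).1 hsmul

theorem adjoin_mulOp_del_eq_top {n : ℕ} [CharZero k] :
    Algebra.adjoin k (Set.range (mulOp k (Poly n k)) ∪ Set.range (del k)) = ⊤ := by
  refine eq_top_iff.2 fun P _ => ?_
  obtain ⟨p, hp⟩ := P.2
  have h := hp.mem_weylAlgebra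
  have himage :
      (Set.range (Algebra.lmul k (Poly n k)) ∪ Set.range fun i => (pderiv i).toLinearMap) =
        (DiffOp k (Poly n k)).val '' (Set.range (mulOp k (Poly n k)) ∪ Set.range (del k)) := by
    rw [Set.image_union, ← Set.range_comp, ← Set.range_comp]
    rfl
  rw [weylAlgebra, himage, ← AlgHom.map_adjoin] at h
  obtain ⟨Q, hQ, hQP⟩ := h
  rwa [← Subtype.ext hQP]

theorem diff_smul_mem {n : ℕ} [CharZero k] {M : Type*} [AddCommGroup M] [Module (Poly n k) M]
    [Module (Diff n k) M] [IsScalarTower (Poly n k) (Diff n k) M] {N : Submodule (Poly n k) M}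
    (hN : ∀ i : Fin n, ∀ m ∈ N, del k i • m ∈ N) (P : Diff n k) {m : M} (hm : m ∈ N) :
    P • m ∈ N := by
  have hP : P ∈ Algebra.adjoin k (Set.range (mulOp k (Poly n k)) ∪ Set.range (del k)) := by
    rw [adjoin_mulOp_del_eq_top]
    exact Algebra.mem_top
  induction hP using Algebra.adjoin_induction generalizing m with
  | mem P hP =>
    obtain ⟨f, rfl⟩ | ⟨i, rfl⟩ := hP
    · rw [mulOp_smul]
      exact N.smul_mem f hm
    · exact hN i m hm
  | algebraMap c =>
    rw [← (mulOp k (Poly n k)).commutes c, mulOp_smul]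
    exact N.smul_mem _ hm
  | add P Q _ _ ihP ihQ =>
    rw [add_smul]
    exact N.add_mem (ihP hm) (ihQ hm)
  | mul P Q _ _ ihP ihQ =>
    rw [mul_smul]
    exact ihP (ihQ hm)

end Weyl

section Koszul

variable {k A : Type*} [CommRing k] [CommRing A] [Algebra k A] {n : ℕ}
  {δ : Fin n → Derivation k A A}
  {N : Type*} [AddCommGroup N] [Module k N] [Module A N]

theorem wedgeSign_mul_self (s : Fin n) (T : Finset (Fin n)) :
    wedgeSign s T * wedgeSign s T = 1 := by
  rw [wedgeSign, ← mul_pow, neg_one_mul, neg_neg, one_pow]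

/-- The differential on families of coefficients indexed by all sets of indices, that is, on sums
of forms of different degrees. -/
def Connection.dTotal (D : Connection δ N) (f : Finset (Fin n) → N) (T : Finset (Fin n)) : N :=
  ∑ s ∈ T, wedgeSign s T • D.op s (f (T.erase s))

/-- Contraction with the vector field `∂ₛ`, on sums of forms of different degrees. -/
def contractTotal (s : Fin n) (f : Finset (Fin n) → N) (T : Finset (Fin n)) : N :=
  if s ∈ T then 0 else wedgeSign s (insert s T) • f (insert s T)

theorem contractTotal_of_mem {s : Fin n} {T : Finset (Fin n)} (hs : s ∈ T)
    (f : Finset (Fin n) → N) : contractTotal s f T = 0 := if_pos hs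

theorem contractTotal_of_notMem {s : Fin n} {T : Finset (Fin n)} (hs : s ∉ T)
    (f : Finset (Fin n) → N) :
    contractTotal s f T = wedgeSign s (insert s T) • f (insert s T) := if_neg hs

theorem wedgeSign_insert_mul {s t : Fin n} {T : Finset (Fin n)} (hs : s ∉ T) (ht : t ∈ T) :
    wedgeSign s (insert s T) * wedgeSign t (insert s T) =
      -(wedgeSign t T * wedgeSign s (insert s (T.erase t))) := by
  have hts : s ≠ t := fun h => hs (h ▸ ht)
  have hswap := wedgeSign_swap (Finset.mem_insert_self s T) (Finset.mem_insert_of_mem ht) hts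
  rw [Finset.erase_insert hs, Finset.erase_insert_of_ne hts] at hswap
  linear_combination
    wedgeSign s (insert s T) * wedgeSign s (insert s (T.erase t)) * hswap
      - wedgeSign s (insert s T) * wedgeSign t (insert s T) *
        wedgeSign_mul_self s (insert s (T.erase t))
      - wedgeSign t T * wedgeSign s (insert s (T.erase t)) * wedgeSign_mul_self s (insert s T)

theorem Connection.contractTotal_dTotal_add (D : Connection δ N) (s : Fin n)
    (f : Finset (Fin n) → N) (T : Finset (Fin n)) :
    contractTotal s (D.dTotal f) T + D.dTotal (contractTotal s f) T = D.op s (f T) := by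
  by_cases hs : s ∈ T
  · rw [contractTotal_of_mem hs, zero_add, dTotal, Finset.sum_eq_single_of_mem s hs,
      contractTotal_of_notMem (Finset.notMem_erase s T), Finset.insert_erase hs, map_zsmul,
      smul_smul, wedgeSign_mul_self, one_smul]
    intro t _ hts
    rw [contractTotal_of_mem (Finset.mem_erase.2 ⟨hts.symm, hs⟩), map_zero, smul_zero]
  · rw [contractTotal_of_notMem hs, dTotal, dTotal, Finset.sum_insert hs, smul_add, smul_smul,
      wedgeSign_mul_self, one_smul, Finset.erase_insert hs, Finset.smul_sum, add_assoc,
      ← Finset.sum_add_distrib, Finset.sum_eq_zero, add_zero]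
    intro t ht
    have hts : s ≠ t := fun h => hs (h ▸ ht)
    rw [contractTotal_of_notMem (fun h => hs (Finset.mem_of_mem_erase h)), smul_smul, map_zsmul,
      smul_smul, Finset.erase_insert_of_ne hts, wedgeSign_insert_mul hs ht, neg_smul,
      neg_add_cancel]

/-- The coefficients of a form, extended by zero to all sets of indices. -/
def Form.coeff {i : ℕ} (ω : Form n N i) (S : Finset (Fin n)) : N :=
  if h : S.card = i then ω ⟨S, h⟩ else 0

theorem Form.coeff_coe {i : ℕ} (ω : Form n N i) (S : {S : Finset (Fin n) // S.card = i}) :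
    ω.coeff S.1 = ω S := dif_pos S.2

theorem Form.coeff_of_card_ne {i : ℕ} (ω : Form n N i) {S : Finset (Fin n)} (h : S.card ≠ i) :
    ω.coeff S = 0 := dif_neg h

theorem Connection.d_apply (D : Connection δ N) (i : ℕ) (ω : Form n N i)
    (T : {S : Finset (Fin n) // S.card = i + 1}) : D.d i ω T = D.dTotal ω.coeff T.1 := by
  rw [dTotal, ← Finset.sum_coe_sort]
  exact Finset.sum_congr rfl fun s _ => congrArg _ (congrArg _ (Form.coeff_coe ω ⟨_, _⟩).symm)

theorem Connection.coeff_d (D : Connection δ N) {i : ℕ} (ω : Form n N i) :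
    Form.coeff (D.d i ω) = D.dTotal ω.coeff := by
  funext T
  by_cases hT : T.card = i + 1
  · rw [Form.coeff_coe _ ⟨T, hT⟩, d_apply]
  · refine (Form.coeff_of_card_ne _ hT).trans (Finset.sum_eq_zero fun s hs => ?_).symm
    rw [Form.coeff_of_card_ne, map_zero, smul_zero]
    rwa [← Finset.card_erase_add_one hs, Nat.add_right_cancel_iff] at hT

/-- Contraction of forms with the vector field `∂ₛ`. -/
def contract (s : Fin n) {i : ℕ} (ω : Form n N (i + 1)) : Form n N i :=
  fun T => contractTotal s ω.coeff T.1

theorem coeff_contract (s : Fin n) {i : ℕ} (ω : Form n N (i + 1)) :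
    Form.coeff (contract s ω) = contractTotal s ω.coeff := by
  funext T
  by_cases hT : T.card = i
  · exact Form.coeff_coe _ ⟨T, hT⟩
  · rw [Form.coeff_of_card_ne _ hT]
    by_cases hs : s ∈ T
    · rw [contractTotal_of_mem hs]
    · rw [contractTotal_of_notMem hs, Form.coeff_of_card_ne, smul_zero]
      rwa [Finset.card_insert_of_notMem hs, Ne, Nat.add_right_cancel_iff]

theorem Connection.contract_d_zero (D : Connection δ N) (s : Fin n) (ω : Form n N 0) :
    contract s (D.d 0 ω) = D.op s ∘ ω := by
  have hzero : contractTotal s ω.coeff = 0 := by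
    funext T
    by_cases hs : s ∈ T
    · exact contractTotal_of_mem hs _
    · rw [contractTotal_of_notMem hs, Form.coeff_of_card_ne _ (Finset.card_ne_zero.2 (by simp)),
        smul_zero, Pi.zero_apply]
  funext T
  have h := D.contractTotal_dTotal_add s ω.coeff T.1
  rw [hzero, ← coeff_d, Form.coeff_coe] at h
  rw [Function.comp_apply, ← h, contract, dTotal, left_eq_add]
  exact Finset.sum_eq_zero fun t _ => by rw [Pi.zero_apply, map_zero, smul_zero]

theorem Connection.contract_d_add_d_contract (D : Connection δ N) (s : Fin n) {i : ℕ}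
    (ω : Form n N (i + 1)) :
    contract s (D.d (i + 1) ω) + D.d i (contract s ω) = D.op s ∘ ω := by
  funext T
  have h := D.contractTotal_dTotal_add s ω.coeff T.1
  rwa [← coeff_d, ← coeff_contract s ω, ← d_apply, Form.coeff_coe] at h

/-- The forms of degree `i` with coefficients in `P`. -/
def formsIn (P : Submodule A N) (i : ℕ) : Submodule A (Form n N i) :=
  Submodule.pi Set.univ fun _ => P

theorem mem_formsIn {P : Submodule A N} {i : ℕ} {ω : Form n N i} :
    ω ∈ formsIn P i ↔ ∀ S, ω S ∈ P := by
  simp [formsIn]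

theorem formsIn_mono {P Q : Submodule A N} (h : P ≤ Q) (i : ℕ) :
    (formsIn P i : Submodule A (Form n N i)) ≤ formsIn Q i :=
  Submodule.pi_mono fun _ _ => h

theorem coeff_mem {P : Submodule A N} {i : ℕ} {ω : Form n N i} (hω : ω ∈ formsIn P i)
    (S : Finset (Fin n)) : ω.coeff S ∈ P := by
  unfold Form.coeff
  split_ifs
  · exact mem_formsIn.1 hω _
  · exact P.zero_mem

theorem contract_mem_formsIn (s : Fin n) {P : Submodule A N} {i : ℕ} {ω : Form n N (i + 1)}
    (hω : ω ∈ formsIn P (i + 1)) : contract s ω ∈ formsIn P i := by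
  refine mem_formsIn.2 fun T => ?_
  rw [contract, contractTotal]
  split_ifs
  · exact P.zero_mem
  · exact zsmul_mem (coeff_mem hω _) _

theorem Connection.d_mem_formsIn (D : Connection δ N) {P Q : Submodule A N}
    (hPQ : ∀ s, ∀ m ∈ P, D.op s m ∈ Q) {i : ℕ} {ω : Form n N i} (hω : ω ∈ formsIn P i) :
    D.d i ω ∈ formsIn Q (i + 1) := by
  refine mem_formsIn.2 fun T => ?_
  rw [d_apply]
  exact Q.sum_mem fun s _ => zsmul_mem (hPQ s _ (coeff_mem hω _)) _

theorem Connection.d_smul_sub_mem_formsIn (D : Connection δ N) {P : Submodule A N} (a : A)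
    {i : ℕ} {ω : Form n N i} (hω : ω ∈ formsIn P i) :
    D.d i (a • ω) - a • D.d i ω ∈ formsIn P (i + 1) := by
  refine mem_formsIn.2 fun T => ?_
  have hsum : (D.d i (a • ω) - a • D.d i ω) T = ∑ s ∈ T.1, wedgeSign s T.1 •
      δ s a • ω.coeff (T.1.erase s) := by
    have hcoeff : Form.coeff (a • ω) = a • ω.coeff := by
      funext S
      simp only [Form.coeff, Pi.smul_apply, smul_dite, smul_zero]
    simp only [Pi.sub_apply, Pi.smul_apply, d_apply, hcoeff, dTotal, D.leibniz, Finset.smul_sum,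
      ← Finset.sum_sub_distrib, smul_comm a (wedgeSign _ _), ← smul_sub, add_sub_cancel_left]
  rw [hsum]
  exact P.sum_mem fun s _ => zsmul_mem (P.smul_mem _ (coeff_mem hω _)) _

/-- Forms with coefficients in `P` whose differential has coefficients in `P`. When `P` runs through
a good filtration, their symbols are the cycles of the Koszul complex of the associated graded
module. -/
def Connection.symbolCycles (D : Connection δ N) (P : Submodule A N) (i : ℕ) :
    Submodule A (Form n N i) where
  carrier := {η | η ∈ formsIn P i ∧ D.d i η ∈ formsIn P (i + 1)}
  zero_mem' := ⟨zero_mem _, by rw [map_zero]; exact zero_mem _⟩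
  add_mem' ha hb := ⟨add_mem ha.1 hb.1, by rw [map_add]; exact add_mem ha.2 hb.2⟩
  smul_mem' c _ ha := ⟨Submodule.smul_mem _ c ha.1, (Submodule.sub_mem_iff_left _
    (Submodule.smul_mem _ c ha.2)).1 (D.d_smul_sub_mem_formsIn c ha.1)⟩

/-- Forms that agree modulo coefficients in `P` with the differential of a form with coefficients
in `P`. When `P` runs through a good filtration, their symbols are the boundaries of the Koszul
complex of the associated graded module. -/
def Connection.symbolBoundaries (D : Connection δ N) (P : Submodule A N) :
    (i : ℕ) → Submodule A (Form n N i)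
  | 0 => formsIn P 0
  | i + 1 =>
    { carrier := {η | ∃ θ ∈ formsIn P i, η - D.d i θ ∈ formsIn P (i + 1)}
      zero_mem' := ⟨0, zero_mem _, by rw [map_zero, sub_zero]; exact zero_mem _⟩
      add_mem' := by
        rintro η η' ⟨θ, hθ, h⟩ ⟨θ', hθ', h'⟩
        refine ⟨θ + θ', add_mem hθ hθ', ?_⟩
        rw [map_add, add_sub_add_comm]
        exact add_mem h h'
      smul_mem' := by
        rintro c η ⟨θ, hθ, h⟩
        refine ⟨c • θ, Submodule.smul_mem _ c hθ, ?_⟩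
        have hsub := sub_mem (Submodule.smul_mem _ c h) (D.d_smul_sub_mem_formsIn c hθ)
        rwa [smul_sub, sub_sub_sub_cancel_right] at hsub }

variable (D : Connection δ N) {P Q : Submodule A N} {i : ℕ} {η : Form n N i}

theorem Connection.mem_symbolBoundaries_of_mem_formsIn (h : η ∈ formsIn P i) :
    η ∈ D.symbolBoundaries P i := by
  cases i with
  | zero => exact h
  | succ i => exact ⟨0, zero_mem _, by rwa [map_zero, sub_zero]⟩

theorem Connection.exists_d_eq_of_mem_symbolBoundaries (h : η ∈ D.symbolBoundaries P i) :
    ∃ η' ∈ formsIn P i, D.d i η' = D.d i η := by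
  cases i with
  | zero => exact ⟨η, h, rfl⟩
  | succ i =>
    obtain ⟨θ, -, h'⟩ := h
    exact ⟨η - D.d i θ, h', by rw [map_sub, D.d_d, sub_zero]⟩

theorem Connection.symbolBoundaries_le_symbolCycles (hle : P ≤ Q)
    (hPQ : ∀ s, ∀ m ∈ P, D.op s m ∈ Q) (i : ℕ) :
    D.symbolBoundaries P i ≤ D.symbolCycles Q i := by
  intro η h
  obtain ⟨η', hη', hd⟩ := D.exists_d_eq_of_mem_symbolBoundaries h
  refine ⟨?_, hd ▸ D.d_mem_formsIn hPQ hη'⟩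
  cases i with
  | zero => exact formsIn_mono hle _ h
  | succ i =>
    obtain ⟨θ, hθ, h'⟩ := h
    exact (Submodule.sub_mem_iff_left _ (D.d_mem_formsIn hPQ hθ)).1 (formsIn_mono hle _ h')

-- By Cartan's formula, contraction with `∂ₛ` is a homotopy between `∂ₛ` and zero.
theorem Connection.op_comp_mem_symbolBoundaries (s : Fin n) (h : η ∈ D.symbolCycles P i) :
    D.op s ∘ η ∈ D.symbolBoundaries P i := by
  cases i with
  | zero =>
    rw [← D.contract_d_zero]
    exact contract_mem_formsIn s h.2
  | succ i =>
    refine ⟨contract s η, contract_mem_formsIn s h.1, ?_⟩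
    rw [← D.contract_d_add_d_contract, add_sub_cancel_right]
    exact contract_mem_formsIn s h.2

end Koszul

section Filtration

open MvPolynomial

variable {k A : Type*} [CommRing k] [CommRing A] [Algebra k A] {n : ℕ}
  {δ : Fin n → Derivation k A A}
  {N : Type*} [AddCommGroup N] [Module k N] [Module A N] (D : Connection δ N)

theorem Connection.pairwise_commute_op_pow (β : Fin n →₀ ℕ) :
    (↑(Finset.univ : Finset (Fin n)) : Set (Fin n)).Pairwise
      (Function.onFun Commute fun s => D.op s ^ β s) :=
  fun s _ t _ _ => Commute.pow_pow (LinearMap.ext (D.comm s t)) (β s) (β t)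

/-- The operator `∂^β = ∂₁^β₁ ⋯ ∂ₙ^βₙ`. -/
def Connection.opMonomial (β : Fin n →₀ ℕ) : Module.End k N :=
  Finset.univ.noncommProd (fun s => D.op s ^ β s) (D.pairwise_commute_op_pow β)

theorem Connection.opMonomial_zero : D.opMonomial 0 = 1 :=
  (Finset.noncommProd_eq_pow_card _ _ _ 1 fun s _ => pow_zero (D.op s)).trans (one_pow _)

theorem Connection.opMonomial_single_add (s : Fin n) (β : Fin n →₀ ℕ) :
    D.opMonomial (Finsupp.single s 1 + β) = D.op s * D.opMonomial β := by
  rw [opMonomial, opMonomial, ← Finset.mul_noncommProd_erase _ (Finset.mem_univ s),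
    ← Finset.mul_noncommProd_erase _ (Finset.mem_univ s) (fun s => D.op s ^ β s), ← mul_assoc,
    ← pow_succ']
  congr 1
  · rw [Finsupp.add_apply, Finsupp.single_eq_same, add_comm]
  · refine Finset.noncommProd_congr rfl (fun t ht => ?_) _
    rw [Finsupp.add_apply, Finsupp.single_eq_of_ne (Finset.ne_of_mem_erase ht), zero_add]

variable {ι : Type*} (g : ι → N)

/-- The `q`-th step of the filtration by order generated by the family `g`. -/
def Connection.fil (q : ℕ) : Submodule A N :=
  Submodule.span A {m | ∃ a β, β.degree ≤ q ∧ D.opMonomial β (g a) = m}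

theorem Connection.fil_mono : Monotone (D.fil g) := fun _ _ hpq =>
  Submodule.span_mono fun _ ⟨a, β, hβ, h⟩ => ⟨a, β, hβ.trans hpq, h⟩

variable {g}

theorem Connection.opMonomial_mem_fil (a : ι) {β : Fin n →₀ ℕ} {q : ℕ} (hβ : β.degree ≤ q) :
    D.opMonomial β (g a) ∈ D.fil g q :=
  Submodule.subset_span ⟨a, β, hβ, rfl⟩

theorem Connection.op_mem_fil {q : ℕ} (s : Fin n) {m : N} (hm : m ∈ D.fil g q) :
    D.op s m ∈ D.fil g (q + 1) := by
  induction hm using Submodule.span_induction with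
  | mem m hm =>
    obtain ⟨a, β, hβ, rfl⟩ := hm
    rw [← Module.End.mul_apply, ← opMonomial_single_add]
    refine D.opMonomial_mem_fil a ?_
    rw [map_add, Finsupp.degree_single]
    omega
  | zero => rw [map_zero]; exact zero_mem _
  | add m m' _ _ hm hm' => rw [map_add]; exact add_mem hm hm'
  | smul a m hm hop =>
    rw [D.leibniz]
    exact add_mem (Submodule.smul_mem _ a hop)
      (Submodule.smul_mem _ _ (D.fil_mono g q.le_succ hm))

theorem Connection.fil_fg [Finite ι] (q : ℕ) : (D.fil g q).FG := by
  refine Submodule.fg_span (((Set.finite_univ.prod (Finsupp.finite_of_degree_le q)).image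
    fun x : ι × (Fin n →₀ ℕ) => D.opMonomial x.2 (g x.1)).subset ?_)
  rintro m ⟨a, β, hβ, rfl⟩
  exact ⟨(a, β), ⟨Set.mem_univ a, hβ⟩, rfl⟩

theorem Connection.symbolBoundaries_fil_le_symbolCycles (p i : ℕ) :
    D.symbolBoundaries (D.fil g p) i ≤ D.symbolCycles (D.fil g (p + 1)) i :=
  D.symbolBoundaries_le_symbolCycles (D.fil_mono g p.le_succ) (fun s _ => D.op_mem_fil s) i

theorem Connection.exists_le_fil (hg : ∀ m, ∃ q, m ∈ D.fil g q) {P : Submodule A N} (hP : P.FG) :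
    ∃ q, P ≤ D.fil g q := by
  obtain ⟨t, rfl⟩ := hP
  choose q hq using hg
  exact ⟨t.sup q, Submodule.span_le.2 fun m hm => D.fil_mono g (Finset.le_sup hm) (hq m)⟩

theorem X_smul_single [DecidableEq ι] (s : Fin n) (a : ι) (β : Fin n →₀ ℕ) :
    (X s : MvPolynomial (Fin n) A) • (Pi.single a (monomial β 1) : ι → MvPolynomial (Fin n) A) =
      Pi.single a (monomial (Finsupp.single s 1 + β) 1) := by
  rw [← Pi.single_smul, smul_eq_mul, X, monomial_mul, one_mul]

variable [Finite ι]

/-- The element `∑ u_{a,β} ∂^β g_a` of `N`, the sum being over the monomials `ξ^β` of degree `q`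
only: an element of `D.fil g q` whose symbol is the degree `q` part of `u`. -/
def Connection.ofSymbol (g : ι → N) (q : ℕ) : (ι → MvPolynomial (Fin n) A) →ₗ[A] N :=
  letI := Fintype.ofFinite ι
  (Pi.basis fun _ : ι => basisMonomials (Fin n) A).constr A fun x =>
    if x.2.degree = q then D.opMonomial x.2 (g x.1) else 0

theorem Connection.ofSymbol_single [DecidableEq ι] (q : ℕ) (a : ι) (β : Fin n →₀ ℕ) :
    D.ofSymbol g q (Pi.single a (monomial β 1)) =
      if β.degree = q then D.opMonomial β (g a) else 0 := by
  let _ := Fintype.ofFinite ι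
  have h := (Pi.basis fun _ : ι => basisMonomials (Fin n) A).constr_basis A
    (fun x => if x.2.degree = q then D.opMonomial x.2 (g x.1) else 0) ⟨a, β⟩
  rwa [Pi.basis_apply, coe_basisMonomials] at h

theorem symbol_induction [DecidableEq ι] {p : (ι → MvPolynomial (Fin n) A) → Prop}
    (single : ∀ a β, p (Pi.single a (monomial β 1))) (zero : p 0)
    (add : ∀ u v, p u → p v → p (u + v)) (smul : ∀ (c : A) u, p u → p (c • u))
    (u : ι → MvPolynomial (Fin n) A) : p u := by
  cases nonempty_fintype ι
  have hu := (Pi.basis fun _ : ι => basisMonomials (Fin n) A).mem_span u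
  induction hu using Submodule.span_induction with
  | mem u hu =>
    obtain ⟨⟨a, β⟩, rfl⟩ := hu
    rw [Pi.basis_apply, coe_basisMonomials]
    exact single a β
  | zero => exact zero
  | add u v _ _ hu hv => exact add u v hu hv
  | smul c u _ hu => exact smul c u hu

theorem Connection.ofSymbol_mem_fil (q : ℕ) (u : ι → MvPolynomial (Fin n) A) :
    D.ofSymbol g q u ∈ D.fil g q := by
  classical
  induction u using symbol_induction with
  | single a β =>
    rw [ofSymbol_single]
    split_ifs with hβ
    · exact D.opMonomial_mem_fil a hβ.le
    · exact zero_mem _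
  | zero => rw [map_zero]; exact zero_mem _
  | add u v hu hv => rw [map_add]; exact add_mem hu hv
  | smul c u hu => rw [map_smul]; exact Submodule.smul_mem _ c hu

theorem Connection.ofSymbol_zero_X_smul (s : Fin n) (u : ι → MvPolynomial (Fin n) A) :
    D.ofSymbol g 0 ((X s : MvPolynomial (Fin n) A) • u) = 0 := by
  classical
  induction u using symbol_induction with
  | single a β =>
    rw [X_smul_single, ofSymbol_single, map_add, Finsupp.degree_single, if_neg (by omega)]
  | zero => rw [smul_zero, map_zero]
  | add u v hu hv => rw [smul_add, map_add, hu, hv, add_zero]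
  | smul c u hu => rw [smul_comm, map_smul, hu, smul_zero]

theorem Connection.ofSymbol_succ_X_smul_sub_mem (q : ℕ) (s : Fin n)
    (u : ι → MvPolynomial (Fin n) A) :
    D.ofSymbol g (q + 1) ((X s : MvPolynomial (Fin n) A) • u) - D.op s (D.ofSymbol g q u) ∈
      D.fil g q := by
  classical
  induction u using symbol_induction with
  | single a β =>
    rw [X_smul_single, ofSymbol_single, ofSymbol_single, map_add, Finsupp.degree_single,
      opMonomial_single_add, add_comm 1, apply_ite (D.op s), map_zero]
    simp only [Nat.add_right_cancel_iff, Module.End.mul_apply, sub_self, zero_mem]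
  | zero => simp only [smul_zero, map_zero, sub_zero, zero_mem]
  | add u v hu hv =>
    rw [smul_add, map_add, map_add, map_add, add_sub_add_comm]
    exact add_mem hu hv
  | smul c u hu =>
    rw [smul_comm, map_smul, (D.ofSymbol g q).map_smul, D.leibniz, ← sub_sub, ← smul_sub]
    exact sub_mem (Submodule.smul_mem _ c hu) (Submodule.smul_mem _ _ (D.ofSymbol_mem_fil q u))

theorem Connection.exists_sub_ofSymbol_mem_fil {q : ℕ} {m : N} (hm : m ∈ D.fil g (q + 1)) :
    ∃ u : ι → MvPolynomial (Fin n) A, (∀ p ≠ q + 1, D.ofSymbol g p u = 0) ∧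
      m - D.ofSymbol g (q + 1) u ∈ D.fil g q := by
  classical
  induction hm using Submodule.span_induction with
  | mem m hm =>
    obtain ⟨a, β, hβ, rfl⟩ := hm
    by_cases hβq : β.degree = q + 1
    · refine ⟨Pi.single a (monomial β 1), fun p hp => ?_, ?_⟩
      · rw [ofSymbol_single, if_neg (hβq ▸ hp.symm)]
      · rw [ofSymbol_single, if_pos hβq, sub_self]
        exact zero_mem _
    · refine ⟨0, fun p _ => map_zero _, ?_⟩
      rw [map_zero, sub_zero]
      exact D.opMonomial_mem_fil a (by omega)
  | zero => exact ⟨0, fun p _ => map_zero _, by rw [map_zero, sub_zero]; exact zero_mem _⟩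
  | add m m' _ _ hm hm' =>
    obtain ⟨u, hu, hmu⟩ := hm
    obtain ⟨v, hv, hmv⟩ := hm'
    refine ⟨u + v, fun p hp => by rw [map_add, hu p hp, hv p hp, add_zero], ?_⟩
    rw [map_add, add_sub_add_comm]
    exact add_mem hmu hmv
  | smul c m _ hm =>
    obtain ⟨u, hu, hmu⟩ := hm
    refine ⟨c • u, fun p hp => by rw [map_smul, hu p hp, smul_zero], ?_⟩
    rw [map_smul, ← smul_sub]
    exact Submodule.smul_mem _ c hmu

/-- An `A`-submodule of an `A[ξ]`-module that is stable under the variables, as an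
`A[ξ]`-submodule. -/
def submoduleOfXSMulMem {σ L : Type*} [AddCommGroup L] [Module A L] [Module (MvPolynomial σ A) L]
    [IsScalarTower A (MvPolynomial σ A) L] (S : Submodule A L)
    (hS : ∀ s, ∀ u ∈ S, (X s : MvPolynomial σ A) • u ∈ S) : Submodule (MvPolynomial σ A) L where
  __ := S
  smul_mem' f u hu := by
    change f • u ∈ S
    induction f using MvPolynomial.induction_on with
    | C c =>
      rw [← algebraMap_eq, algebraMap_smul]
      exact S.smul_mem c hu
    | add f f' hf hf' => rw [add_smul]; exact S.add_mem hf hf'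
    | mul_X f s hf => rw [mul_comm, mul_smul]; exact hS s _ hf

variable (g) in
/-- The symbols of forms all of whose homogeneous components are cycles of the Koszul complex,
those in degrees greater than `q` being boundaries. -/
def Connection.cycleSymbols (i q : ℕ) : Submodule A (Form n (ι → MvPolynomial (Fin n) A) i) :=
  (⨅ p, (D.symbolCycles (D.fil g p) i).comap ((D.ofSymbol g p).compLeft _)) ⊓
    ⨅ p, ⨅ _ : q ≤ p, (D.symbolBoundaries (D.fil g p) i).comap ((D.ofSymbol g (p + 1)).compLeft _)

theorem Connection.mem_cycleSymbols {i q : ℕ} {u : Form n (ι → MvPolynomial (Fin n) A) i} :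
    u ∈ D.cycleSymbols g i q ↔ (∀ p, D.ofSymbol g p ∘ u ∈ D.symbolCycles (D.fil g p) i) ∧
      ∀ p ≥ q, D.ofSymbol g (p + 1) ∘ u ∈ D.symbolBoundaries (D.fil g p) i := by
  simp only [cycleSymbols, Submodule.mem_inf, Submodule.mem_iInf, Submodule.mem_comap]
  rfl

theorem Connection.X_smul_mem_cycleSymbols {i q : ℕ} (s : Fin n)
    {u : Form n (ι → MvPolynomial (Fin n) A) i} (hu : u ∈ D.cycleSymbols g i q) :
    (X s : MvPolynomial (Fin n) A) • u ∈ D.cycleSymbols g i q := by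
  rw [mem_cycleSymbols] at hu ⊢
  have hB (p : ℕ) : D.ofSymbol g (p + 1) ∘ ((X s : MvPolynomial (Fin n) A) • u) ∈
      D.symbolBoundaries (D.fil g p) i := by
    have hsub : D.ofSymbol g (p + 1) ∘ ((X s : MvPolynomial (Fin n) A) • u) -
        D.op s ∘ D.ofSymbol g p ∘ u ∈ formsIn (D.fil g p) i :=
      mem_formsIn.2 fun S => D.ofSymbol_succ_X_smul_sub_mem p s (u S)
    exact (Submodule.sub_mem_iff_left _ (D.op_comp_mem_symbolBoundaries s (hu.1 p))).1
      (D.mem_symbolBoundaries_of_mem_formsIn hsub)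
  refine ⟨fun p => ?_, fun p _ => hB p⟩
  cases p with
  | zero =>
    rw [show D.ofSymbol g 0 ∘ ((X s : MvPolynomial (Fin n) A) • u) = 0 from
      funext fun S => D.ofSymbol_zero_X_smul s (u S)]
    exact zero_mem _
  | succ p => exact D.symbolBoundaries_fil_le_symbolCycles p i (hB p)

variable (g) in
theorem Connection.exists_cycleSymbols_eq [IsNoetherianRing A] (i : ℕ) :
    ∃ q₀, ∀ q ≥ q₀, D.cycleSymbols g i q = D.cycleSymbols g i q₀ := by
  let T : ℕ →o Submodule (MvPolynomial (Fin n) A) (Form n (ι → MvPolynomial (Fin n) A) i) :=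
    { toFun q := submoduleOfXSMulMem (D.cycleSymbols g i q) fun s _ => D.X_smul_mem_cycleSymbols s
      monotone' _ _ hpq _ hu := D.mem_cycleSymbols.2 ((D.mem_cycleSymbols.1 hu).imp_right
        fun h r hr => h r (hpq.trans hr)) }
  obtain ⟨q₀, hq₀⟩ := monotone_stabilizes_iff_noetherian.2 inferInstance T
  exact ⟨q₀, fun q hq => SetLike.ext fun u => (SetLike.ext_iff.1 (hq₀ q hq) u).symm⟩

-- The Koszul homology of the associated graded module is killed by all `ξₛ`, hence is finitely
-- generated over `A` and vanishes in high degrees.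
variable (g) in
theorem Connection.exists_symbolCycles_le_symbolBoundaries [IsNoetherianRing A] (i : ℕ) :
    ∃ q₀, ∀ q ≥ q₀, D.symbolCycles (D.fil g (q + 1)) i ≤ D.symbolBoundaries (D.fil g q) i := by
  obtain ⟨q₀, hq₀⟩ := D.exists_cycleSymbols_eq g i
  refine ⟨q₀, fun q hq η hη => ?_⟩
  choose u hu hηu using fun S => D.exists_sub_ofSymbol_mem_fil (mem_formsIn.1 hη.1 S)
  have hsub : η - D.ofSymbol g (q + 1) ∘ u ∈ D.symbolBoundaries (D.fil g q) i :=
    D.mem_symbolBoundaries_of_mem_formsIn (mem_formsIn.2 hηu)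
  have hother {p : ℕ} (hp : p ≠ q + 1) : D.ofSymbol g p ∘ u = 0 := funext fun S => hu S p hp
  have hmem : u ∈ D.cycleSymbols g i (q + 1) := by
    refine D.mem_cycleSymbols.2 ⟨fun p => ?_, fun p hp => ?_⟩
    · rcases eq_or_ne p (q + 1) with rfl | hp
      · exact (Submodule.sub_mem_iff_right _ hη).1 (D.symbolBoundaries_fil_le_symbolCycles q i hsub)
      · rw [hother hp]
        exact zero_mem _
    · rw [hother (by omega)]
      exact zero_mem _
  rw [hq₀ (q + 1) (hq.trans q.le_succ), ← hq₀ q hq] at hmem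
  exact (Submodule.sub_mem_iff_left _ ((D.mem_cycleSymbols.1 hmem).2 q le_rfl)).1 hsub

theorem Connection.exists_bounded_primitive [IsNoetherianRing A]
    (hg : ∀ m, ∃ q, m ∈ D.fil g q) (i p : ℕ) :
    ∃ q, ∀ η : Form n N i, D.d i η ∈ formsIn (D.fil g p) (i + 1) →
      ∃ η' ∈ formsIn (D.fil g q) i, D.d i η' = D.d i η := by
  obtain ⟨q₀, hq₀⟩ := D.exists_symbolCycles_le_symbolBoundaries g i
  refine ⟨max p q₀, fun η hη => ?_⟩
  have descend (r : ℕ) : ∀ η : Form n N i, D.d i η ∈ formsIn (D.fil g p) (i + 1) →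
      η ∈ formsIn (D.fil g (max p q₀ + r)) i →
      ∃ η' ∈ formsIn (D.fil g (max p q₀)) i, D.d i η' = D.d i η := by
    induction r with
    | zero => exact fun η _ h => ⟨η, h, rfl⟩
    | succ r ih =>
      intro η hd h
      have hZ : η ∈ D.symbolCycles (D.fil g (max p q₀ + r + 1)) i :=
        ⟨h, formsIn_mono (D.fil_mono g (by omega)) _ hd⟩
      obtain ⟨η₁, h₁, hd₁⟩ := D.exists_d_eq_of_mem_symbolBoundaries (hq₀ _ (by omega) hZ)
      obtain ⟨η₂, h₂, hd₂⟩ := ih η₁ (hd₁ ▸ hd) h₁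
      exact ⟨η₂, h₂, hd₂.trans hd₁⟩
  choose e he using fun S => hg (η S)
  refine descend (∑ S, e S) η hη (mem_formsIn.2 fun S => D.fil_mono g ?_ (he S))
  exact (Finset.single_le_sum (fun _ _ => Nat.zero_le _) (Finset.mem_univ S)).trans
    (Nat.le_add_left _ _)

end Filtration

section FiniteType

variable {k A : Type*} [CommRing k] [CommRing A] [Algebra k A] {n : ℕ}
  {δ : Fin n → Derivation k A A}
  {N : Type*} [AddCommGroup N] [Module k N] [Module A N]

/-- `N` is generated by finitely many elements over `A` and the operators `∂ₛ` together. -/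
def Connection.FiniteType (D : Connection δ N) : Prop :=
  ∃ s : Finset N, ∀ P : Submodule A N, ↑s ⊆ (P : Set N) →
    (∀ i, ∀ m ∈ P, D.op i m ∈ P) → P = ⊤

theorem Connection.FiniteType.exists_fil {D : Connection δ N} (hD : D.FiniteType) :
    ∃ s : Finset N, ∀ m, ∃ q, m ∈ D.fil ((↑) : s → N) q := by
  obtain ⟨s, hs⟩ := hD
  have hmem (m : N) : m ∈ ⨆ q, D.fil ((↑) : s → N) q ↔ ∃ q, m ∈ D.fil ((↑) : s → N) q :=
    Submodule.mem_iSup_of_directed _ (D.fil_mono _).directed_le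
  refine ⟨s, fun m => (hmem m).1 ?_⟩
  rw [hs (⨆ q, D.fil ((↑) : s → N) q) (fun m hm => (hmem m).2 ⟨0, ?_⟩) fun i m hm => ?_]
  · exact Submodule.mem_top
  · have h := D.opMonomial_mem_fil (g := ((↑) : s → N)) ⟨m, hm⟩ (map_zero Finsupp.degree).le
    rwa [opMonomial_zero] at h
  · obtain ⟨q, hq⟩ := (hmem m).1 hm
    exact (hmem _).2 ⟨q + 1, D.op_mem_fil i hq⟩

theorem conn_finiteType (n : ℕ) (k : Type*) [Field k] [CharZero k] (M : Type*) [AddCommGroup M]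
    [Module (Poly n k) M] [Module (Diff n k) M] [IsScalarTower (Poly n k) (Diff n k) M]
    [Module k M] [IsScalarTower k (Poly n k) M] [Module.Finite (Diff n k) M] :
    (conn n k M).FiniteType := by
  obtain ⟨s, hs⟩ := (Module.Finite.fg_top : (⊤ : Submodule (Diff n k) M).FG)
  refine ⟨s, fun P hsP hP => Submodule.eq_top_iff'.2 fun m => ?_⟩
  have hm : m ∈ Submodule.span (Diff n k) (s : Set M) := hs ▸ Submodule.mem_top
  induction hm using Submodule.span_induction with
  | mem m hm => exact hsP hm
  | zero => exact P.zero_mem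
  | add m m' _ _ hm hm' => exact P.add_mem hm hm'
  | smul Q m _ hm => exact diff_smul_mem hP Q hm

end FiniteType

section HomPart

open MvPolynomial

variable {n : ℕ} {k : Type*} [Field k]

/-- The homogeneous part of degree `j` of a power series, which is `0` for `j < 0`. -/
def homPart (j : ℤ) : PSer n k →ₗ[k] Poly n k :=
  if 0 ≤ j then MvPowerSeries.truncFinset k (Finset.univ.finsuppAntidiag j.toNat) else 0

theorem coeff_homPart (j : ℤ) (s : PSer n k) (β : Fin n →₀ ℕ) :
    coeff β (homPart j s) = if (β.degree : ℤ) = j then MvPowerSeries.coeff β s else 0 := by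
  classical
  rcases lt_or_ge j 0 with hj | hj
  · rw [homPart, if_neg hj.not_ge, if_neg (by omega)]
    rfl
  · lift j to ℕ using hj
    simp only [homPart, Int.natCast_nonneg, if_true, MvPowerSeries.coeff_truncFinset,
      Finset.mem_finsuppAntidiag, Finset.subset_univ, and_true, Int.toNat_natCast, Nat.cast_inj,
      Finsupp.degree_eq_sum]

theorem homPart_isHomogeneous (d : ℕ) (s : PSer n k) :
    (homPart (d : ℤ) s).IsHomogeneous d := by
  intro β hβ
  rw [coeff_homPart, ne_eq, ite_eq_right_iff, Classical.not_imp, Nat.cast_inj] at hβ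
  exact (DFunLike.congr_fun Finsupp.degree_eq_weight_one β).symm.trans hβ.1

theorem homPart_of_neg {j : ℤ} (hj : j < 0) (s : PSer n k) : homPart j s = 0 := by
  rw [homPart, if_neg hj.not_ge, LinearMap.zero_apply]

theorem eq_of_homPart_eq {s t : PSer n k} (h : ∀ j, homPart j s = homPart j t) : s = t := by
  ext β
  have hβ := congrArg (coeff β) (h β.degree)
  rwa [coeff_homPart, coeff_homPart, if_pos rfl, if_pos rfl] at hβ

theorem exists_homPart_eq (p : ℤ → PSer n k) : ∃ s, ∀ j, homPart j s = homPart j (p j) := by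
  let s : PSer n k := fun β => MvPowerSeries.coeff β (p β.degree)
  refine ⟨s, fun j => MvPolynomial.ext _ _ fun β => ?_⟩
  rw [coeff_homPart, coeff_homPart]
  split_ifs with hβ
  · subst hβ
    rfl
  · rfl

theorem homPart_one (j : ℤ) : homPart j (1 : PSer n k) = if j = 0 then 1 else 0 := by
  classical
  ext β
  rw [coeff_homPart, MvPowerSeries.coeff_one, apply_ite (coeff β), coeff_zero, coeff_one]
  rcases eq_or_ne β 0 with rfl | hβ
  · simp only [map_zero, Nat.cast_zero, eq_comm, if_true]
  · simp only [if_neg hβ, if_neg hβ.symm, ite_self]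

theorem homPart_pderiv (j : ℤ) (i : Fin n) (s : PSer n k) :
    homPart j (MvPowerSeries.pderiv k i s) = pderiv i (homPart (j + 1) s) := by
  ext β
  simp only [coeff_homPart, coeff_pderiv, MvPowerSeries.coeff_pderiv, map_add,
    Finsupp.degree_single, Nat.cast_add, Nat.cast_one, add_left_inj, ite_mul, zero_mul]

theorem poly_smul_eq_coe_mul (f : Poly n k) (s : PSer n k) : f • s = (f : PSer n k) * s := by
  rw [Algebra.smul_def, MvPowerSeries.algebraMap_apply', Algebra.algebraMap_self,
    MvPowerSeries.map_id, RingHom.id_apply]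

theorem homPart_smul_of_isHomogeneous {d : ℕ} {f : Poly n k} (hf : f.IsHomogeneous d) (j : ℤ)
    (s : PSer n k) : homPart j (f • s) = f * homPart (j - d) s := by
  classical
  ext β
  rw [coeff_homPart, coeff_mul, poly_smul_eq_coe_mul, MvPowerSeries.coeff_mul]
  rw [Finset.ite_sum_zero]
  refine Finset.sum_congr rfl fun x hx => ?_
  rw [coeff_coe, coeff_homPart, mul_ite, mul_zero]
  by_cases hx₁ : coeff x.1 f = 0
  · rw [hx₁, zero_mul, ite_self, ite_self]
  have hdeg : β.degree = d + x.2.degree := by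
    rw [← Finset.HasAntidiagonal.mem_antidiagonal.1 hx, map_add, ← hf hx₁]
    exact congrArg (· + _) (DFunLike.congr_fun Finsupp.degree_eq_weight_one x.1)
  exact if_congr (by omega) rfl rfl

theorem homPart_homPart_smul (i j : ℤ) (t s : PSer n k) :
    homPart j (homPart i t • s) = homPart i t * homPart (j - i) s := by
  rcases lt_or_ge i 0 with hi | hi
  · rw [homPart_of_neg hi, zero_smul, map_zero, zero_mul]
  · lift i to ℕ using hi
    exact homPart_smul_of_isHomogeneous (homPart_isHomogeneous i t) j s

-- By Noetherianity finitely many `y b` generate all `y l`; the coefficient of `y b` in `y l` can be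
-- taken homogeneous of degree `l - b`, so that letting `l` vary yields a single power series.
theorem exists_series {X : Type*} [AddCommGroup X] [Module (Poly n k) X]
    {N : Submodule (Poly n k) X} (hN : N.FG) (π : ℤ → X →+ X) {y : ℤ → X} (hy : ∀ l, y l ∈ N)
    (hπ : ∀ l b (f : Poly n k), π l (f • y b) = homPart (l - b) (f : PSer n k) • y b) :
    ∃ (L : Finset ℤ) (s : ℤ → PSer n k), ∀ l, ∑ b ∈ L, homPart (l - b) (s b) • y b = y l := by
  classical
  have hfg : (Submodule.span (Poly n k) (y '' Set.univ)).FG :=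
    hN.of_le (Submodule.span_le.2 (Set.image_subset_iff.2 fun l _ => hy l))
  obtain ⟨t, ht, hspan⟩ := (Submodule.fg_span_iff_fg_span_finset_subset _).1 hfg
  obtain ⟨L, -, rfl⟩ := Finset.subset_set_image_iff.1 ht
  have hc (l : ℤ) : ∃ c : ℤ → Poly n k, ∑ b ∈ L, c b • y b = y l := by
    have hl := Submodule.subset_span (R := Poly n k) (Set.mem_image_of_mem y (Set.mem_univ l))
    rw [hspan, Finset.coe_image] at hl
    obtain ⟨c, hc⟩ := (Submodule.mem_span_image_finset_iff_exists_fun' _).1 hl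
    exact ⟨c, hc⟩
  choose c hc using hc
  choose s hs using fun b => exists_homPart_eq fun j => (c (j + b) b : PSer n k)
  refine ⟨L, s, fun l => ?_⟩
  have hl : π l (y l) = y l := by
    have h := hπ l l 1
    rwa [one_smul, sub_self, MvPolynomial.coe_one, homPart_one, if_pos rfl, one_smul] at h
  calc ∑ b ∈ L, homPart (l - b) (s b) • y b = ∑ b ∈ L, π l (c l b • y b) := by
        refine Finset.sum_congr rfl fun b _ => ?_
        rw [hs, sub_add_cancel, hπ]
    _ = y l := by rw [← map_sum, hc, hl]

end HomPart

section GradedModule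

open MvPolynomial

variable {n : ℕ} {k : Type*} [Field k] {X : Type*} [AddCommGroup X] [Module k X]
  [Module (Poly n k) X] {𝓧 : ℤ → Submodule k X}

variable (𝓧) in
/-- `X = ⨁_{l ∈ ℤ} 𝓧 l` is a grading making `X` a graded `R`-module, for the standard grading of
`R = k[x₁, …, xₙ]`. -/
structure IsGradedModule : Prop where
  isInternal : DirectSum.IsInternal 𝓧
  smul_mem : ∀ (d : ℕ) (l : ℤ) (f : Poly n k) (x : X),
    f ∈ homogeneousSubmodule (Fin n) k d → x ∈ 𝓧 l → f • x ∈ 𝓧 (d + l)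

namespace IsGradedModule

variable (h : IsGradedModule (n := n) 𝓧)
include h

@[elab_as_elim]
theorem induction_on {p : X → Prop} (mem : ∀ l, ∀ x ∈ 𝓧 l, p x)
    (add : ∀ x y, p x → p y → p (x + y)) (x : X) : p x := by
  have hx : x ∈ ⨆ l, 𝓧 l := h.isInternal.submodule_iSup_eq_top ▸ Submodule.mem_top
  exact Submodule.iSup_induction 𝓧 (motive := p) hx mem (mem 0 0 (zero_mem _)) add

/-- The decomposition of elements into homogeneous components. -/
def decomp : X ≃ₗ[k] DirectSum ℤ fun l => 𝓧 l :=
  (LinearEquiv.ofBijective (DirectSum.coeLinearMap 𝓧) h.isInternal).symm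

theorem decomp_of_mem {l : ℤ} {x : X} (hx : x ∈ 𝓧 l) :
    h.decomp x = DirectSum.lof k ℤ (fun l => 𝓧 l) l ⟨x, hx⟩ := by
  rw [decomp, LinearEquiv.symm_apply_eq]
  exact (DirectSum.coeLinearMap_lof 𝓧 l ⟨x, hx⟩).symm

/-- The projection onto the homogeneous component of degree `l`. -/
def proj (l : ℤ) : X →ₗ[k] X :=
  (𝓧 l).subtype ∘ₗ DirectSum.component k ℤ (fun l => 𝓧 l) l ∘ₗ h.decomp.toLinearMap

theorem proj_mem (l : ℤ) (x : X) : h.proj l x ∈ 𝓧 l :=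
  Subtype.property _

theorem proj_of_mem {e : ℤ} {x : X} (hx : x ∈ 𝓧 e) (l : ℤ) :
    h.proj l x = if e = l then x else 0 := by
  rw [proj, LinearMap.comp_apply, LinearMap.comp_apply, LinearEquiv.coe_coe, h.decomp_of_mem hx]
  split_ifs with hel
  · subst hel
    rw [DirectSum.component.lof_self, Submodule.subtype_apply]
  · rw [DirectSum.component.of, dif_neg hel, map_zero]

theorem finite_support_proj (x : X) : {l | h.proj l x ≠ 0}.Finite :=
  (DFinsupp.finite_support (h.decomp x)).subset fun _ hl h0 =>
    hl (ZeroMemClass.coe_eq_zero.2 h0)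

theorem finsum_proj (x : X) : ∑ᶠ l, h.proj l x = x := by
  induction x using h.induction_on with
  | mem e x hx =>
    rw [finsum_eq_single _ e fun l hl => by rw [h.proj_of_mem hx, if_neg hl.symm],
      h.proj_of_mem hx, if_pos rfl]
  | add x y hx hy =>
    simp only [map_add]
    rw [finsum_add_distrib (h.finite_support_proj x) (h.finite_support_proj y), hx, hy]

theorem finite_support_proj_comp {ι : Type*} [Finite ι] (ω : ι → X) :
    {l | (h.proj l).compLeft ι ω ≠ 0}.Finite := by
  refine (Set.finite_iUnion fun a => h.finite_support_proj (ω a)).subset fun l hl => ?_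
  obtain ⟨a, ha⟩ := Function.ne_iff.1 hl
  exact Set.mem_iUnion.2 ⟨a, ha⟩

theorem sum_proj_comp {ι : Type*} {ω : ι → X} {Λ : Finset ℤ}
    (hΛ : {l | (h.proj l).compLeft ι ω ≠ 0} ⊆ Λ) : ∑ l ∈ Λ, (h.proj l).compLeft ι ω = ω := by
  funext a
  rw [Finset.sum_apply]
  refine Eq.trans ?_ (h.finsum_proj (ω a))
  exact (finsum_eq_sum_of_support_subset _ fun l hl => hΛ fun h0 => hl (congrFun h0 a)).symm

theorem exists_eq_sum_tmul (x : PSer n k ⊗[Poly n k] X) :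
    ∃ (t : ℕ) (s : Fin t → PSer n k) (d : Fin t → ℤ) (g : Fin t → X), (∀ a, g a ∈ 𝓧 (d a)) ∧
      x = ∑ a, s a ⊗ₜ g a := by
  have hx : x ∈ Submodule.span (PSer n k) {y | ∃ l, ∃ g ∈ 𝓧 l, (1 : PSer n k) ⊗ₜ g = y} := by
    induction x using TensorProduct.induction_on with
    | zero => exact zero_mem _
    | add x y hx hy => exact add_mem hx hy
    | tmul s x =>
      induction x using h.induction_on with
      | add x y hx hy => rw [TensorProduct.tmul_add]; exact add_mem hx hy
      | mem l x hx =>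
        rw [← mul_one s, ← smul_eq_mul, ← TensorProduct.smul_tmul']
        exact Submodule.smul_mem _ s (Submodule.subset_span ⟨l, x, hx, rfl⟩)
  obtain ⟨t, s, y, rfl⟩ := Submodule.mem_span_set'.1 hx
  choose d g hg hy using fun a => (y a).2
  refine ⟨t, s, d, g, hg, Finset.sum_congr rfl fun a _ => ?_⟩
  rw [← hy, TensorProduct.smul_tmul', smul_eq_mul, mul_one]

variable [IsScalarTower k (Poly n k) X]

/-- The biadditive map `(x, s) ↦ ∑ₑ s_{l - e} xₑ`, where `s_j` and `xₑ` are homogeneous parts. -/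
def compBilin (l : ℤ) : X →ₗ[k] PSer n k →ₗ[k] X :=
  DirectSum.toModule k ℤ _ (fun e =>
    ((Algebra.lsmul k k X).toLinearMap ∘ₗ homPart (l - e)).flip ∘ₗ (𝓧 e).subtype) ∘ₗ
    h.decomp.toLinearMap

theorem compBilin_of_mem (l : ℤ) {e : ℤ} {x : X} (hx : x ∈ 𝓧 e) (s : PSer n k) :
    h.compBilin l x s = homPart (l - e) s • x := by
  rw [compBilin, LinearMap.comp_apply, LinearEquiv.coe_coe, h.decomp_of_mem hx,
    DirectSum.toModule_lof]
  rfl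

theorem compBilin_smul (l : ℤ) (f : Poly n k) (s : PSer n k) (x : X) :
    h.compBilin l x (f • s) = h.compBilin l (f • x) s := by
  induction x using h.induction_on with
  | add x y hx hy => simp only [smul_add, map_add, LinearMap.add_apply, hx, hy]
  | mem e x hx =>
    induction f using MvPolynomial.induction_on' with
    | add f g hf hg => simp only [add_smul, map_add, LinearMap.add_apply, hf, hg]
    | monomial β c =>
      have hβ := isHomogeneous_monomial c (rfl : β.degree = β.degree)
      rw [h.compBilin_of_mem l hx, h.compBilin_of_mem l (h.smul_mem _ e _ x hβ hx),
        homPart_smul_of_isHomogeneous hβ, mul_comm, mul_smul, sub_sub, add_comm e]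

/-- The homogeneous component of degree `l` of an element of the completion `R̂ ⊗_R X`. -/
def tensorComp (l : ℤ) : PSer n k ⊗[Poly n k] X →ₗ[k] X where
  __ := TensorProduct.liftAddHom
    (LinearMap.toAddMonoidHom'.comp (h.compBilin l).flip.toAddMonoidHom) (h.compBilin_smul l)
  map_smul' c x := by
    change TensorProduct.liftAddHom _ (h.compBilin_smul l) (c • x) =
      c • TensorProduct.liftAddHom _ (h.compBilin_smul l) x
    induction x using TensorProduct.induction_on with
    | zero => rw [smul_zero, map_zero, smul_zero]
    | tmul s x => exact (h.compBilin l x).map_smul c s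
    | add x y hx hy => rw [smul_add, map_add, map_add, smul_add, hx, hy]

theorem tensorComp_tmul (l : ℤ) {e : ℤ} (s : PSer n k) {x : X} (hx : x ∈ 𝓧 e) :
    h.tensorComp l (s ⊗ₜ x) = homPart (l - e) s • x :=
  h.compBilin_of_mem l hx s

theorem tensorComp_kappa (l : ℤ) (x : X) : h.tensorComp l (kappa n k X x) = h.proj l x := by
  induction x using h.induction_on with
  | mem e x hx =>
    refine (h.tensorComp_tmul l 1 hx).trans ?_
    rw [h.proj_of_mem hx, homPart_one, ite_smul, one_smul, zero_smul]
    exact if_congr (by rw [sub_eq_zero, eq_comm]) rfl rfl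
  | add x y hx hy => rw [map_add, map_add, map_add, hx, hy]

theorem tensorComp_kappa_comp {ι : Type*} (l : ℤ) (ω : ι → X) :
    (h.tensorComp l).compLeft ι ((kappa n k X).compLeft ι ω) = (h.proj l).compLeft ι ω :=
  funext fun a => h.tensorComp_kappa l (ω a)

theorem proj_smul_of_mem (l : ℤ) {e : ℤ} (f : Poly n k) {x : X} (hx : x ∈ 𝓧 e) :
    h.proj l (f • x) = homPart (l - e) (f : PSer n k) • x := by
  have hf : kappa n k X (f • x) = (f : PSer n k) ⊗ₜ x := by
    rw [← mul_one (f : PSer n k), ← poly_smul_eq_coe_mul, TensorProduct.smul_tmul]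
    rfl
  rw [← h.tensorComp_kappa, hf, h.tensorComp_tmul l _ hx]

theorem proj_smul_mem {N : Submodule (Poly n k) X} (f : Poly n k) {x : X}
    (hx : ∀ e, h.proj e x ∈ N) (l : ℤ) : h.proj l (f • x) ∈ N := by
  have hsum := finsum_eq_sum_of_support_subset (fun e => h.proj e x)
    (h.finite_support_proj x).coe_toFinset.superset
  rw [← h.finsum_proj x, hsum, Finset.smul_sum, map_sum]
  refine sum_mem fun e _ => ?_
  rw [h.proj_smul_of_mem l f (h.proj_mem e x)]
  exact N.smul_mem _ (hx e)

theorem tensorComp_mem (l : ℤ) (x : PSer n k ⊗[Poly n k] X) : h.tensorComp l x ∈ 𝓧 l := by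
  induction x using TensorProduct.induction_on with
  | zero => rw [map_zero]; exact zero_mem _
  | add x y hx hy => rw [map_add]; exact add_mem hx hy
  | tmul s x =>
    induction x using h.induction_on with
    | add x y hx hy => rw [TensorProduct.tmul_add, map_add]; exact add_mem hx hy
    | mem e x hx =>
      rw [h.tensorComp_tmul l s hx]
      rcases lt_or_ge (l - e) 0 with hle | hle
      · rw [homPart_of_neg hle, zero_smul]
        exact zero_mem _
      · obtain ⟨d, hd⟩ := Int.eq_ofNat_of_zero_le hle
        rw [hd, eq_add_of_sub_eq hd]
        exact h.smul_mem d e _ x (homPart_isHomogeneous d s) hx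

theorem exists_eq_sum_tmul_tensorComp (x : PSer n k ⊗[Poly n k] X) :
    ∃ (L : Finset ℤ) (F : ℤ → PSer n k), x = ∑ b ∈ L, F b ⊗ₜ h.tensorComp b x := by
  obtain ⟨t, s, d, g, hg, rfl⟩ := h.exists_eq_sum_tmul x
  let v (l : ℤ) (a : Fin t) : Poly n k := homPart (l - d a) (s a)
  have hv (l : ℤ) : h.tensorComp l (∑ a, s a ⊗ₜ g a) = ∑ a, v l a • g a := by
    rw [map_sum]
    exact Finset.sum_congr rfl fun a _ => h.tensorComp_tmul l (s a) (hg a)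
  obtain ⟨L, F, hF⟩ := exists_series (Module.Finite.fg_top : (⊤ : Submodule (Poly n k) _).FG)
    (fun l => (LinearMap.pi fun a => homPart (l - d a) ∘ₗ
      (MvPolynomial.coeToMvPowerSeries.algHom k).toLinearMap ∘ₗ LinearMap.proj a).toAddMonoidHom)
    (y := v) (fun l => Submodule.mem_top) fun l b f => by
      funext a
      have hmul : ((f * v b a : Poly n k) : PSer n k) = v b a • (f : PSer n k) := by
        rw [poly_smul_eq_coe_mul, mul_comm, MvPolynomial.coe_mul]
      change homPart (l - d a) ((f * v b a : Poly n k) : PSer n k) = homPart (l - b) _ * v b a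
      rw [hmul, homPart_homPart_smul, sub_sub_sub_cancel_right, mul_comm]
  have hs (a : Fin t) : s a = ∑ b ∈ L, v b a • F b := by
    refine eq_of_homPart_eq fun j => ?_
    have hj := congrFun (hF (j + d a)) a
    simp only [v, Finset.sum_apply, Pi.smul_apply, smul_eq_mul, add_sub_cancel_right] at hj
    rw [map_sum, ← hj]
    refine Finset.sum_congr rfl fun b _ => ?_
    rw [homPart_homPart_smul, mul_comm, sub_sub_eq_add_sub]
  refine ⟨L, F, ?_⟩
  calc ∑ a, s a ⊗ₜ[Poly n k] g a = ∑ a, ∑ b ∈ L, F b ⊗ₜ[Poly n k] (v b a • g a) := by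
        refine Finset.sum_congr rfl fun a _ => ?_
        rw [hs a, TensorProduct.sum_tmul]
        exact Finset.sum_congr rfl fun b _ => TensorProduct.smul_tmul _ _ _
    _ = ∑ b ∈ L, F b ⊗ₜ[Poly n k] ∑ a, v b a • g a := by
        rw [Finset.sum_comm]
        exact Finset.sum_congr rfl fun b _ => (TensorProduct.tmul_sum _ _ _).symm
    _ = _ := Finset.sum_congr rfl fun b _ => by rw [hv]

theorem eq_of_tensorComp_eq {x y : PSer n k ⊗[Poly n k] X}
    (hxy : ∀ l, h.tensorComp l x = h.tensorComp l y) : x = y := by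
  obtain ⟨L, F, hF⟩ := h.exists_eq_sum_tmul_tensorComp (x - y)
  rw [← sub_eq_zero, hF]
  refine Finset.sum_eq_zero fun b _ => ?_
  rw [map_sub, hxy, sub_self, TensorProduct.tmul_zero]

theorem exists_fg_tensorComp_mem (x : PSer n k ⊗[Poly n k] X) :
    ∃ N : Submodule (Poly n k) X, N.FG ∧ ∀ l, h.tensorComp l x ∈ N := by
  obtain ⟨L, F, hF⟩ := h.exists_eq_sum_tmul_tensorComp x
  refine ⟨Submodule.span _ ((fun b => h.tensorComp b x) '' L),
    Submodule.fg_span (L.finite_toSet.image _), fun l => ?_⟩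
  have hl : h.tensorComp l x = ∑ b ∈ L, homPart (l - b) (F b) • h.tensorComp b x := by
    conv_lhs => rw [hF, map_sum]
    exact Finset.sum_congr rfl fun b _ => h.tensorComp_tmul l _ (h.tensorComp_mem b x)
  rw [hl]
  exact sum_mem fun b hb => Submodule.smul_mem _ _
    (Submodule.subset_span (Set.mem_image_of_mem _ hb))

theorem exists_tensorComp_eq {N : Submodule (Poly n k) X} (hN : N.FG) {y : ℤ → X}
    (hyN : ∀ l, y l ∈ N) (hy : ∀ l, y l ∈ 𝓧 l) : ∃ x, ∀ l, h.tensorComp l x = y l := by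
  obtain ⟨L, s, hs⟩ := exists_series hN (fun l => (h.proj l).toAddMonoidHom) hyN
    fun l b f => h.proj_smul_of_mem l f (hy b)
  refine ⟨∑ b ∈ L, s b ⊗ₜ y b, fun l => ?_⟩
  rw [map_sum, ← hs l]
  exact Finset.sum_congr rfl fun b _ => h.tensorComp_tmul l (s b) (hy b)

theorem exists_fg_proj_mem {V : Submodule (Poly n k) X} (hV : V.FG) :
    ∃ N : Submodule (Poly n k) X, N.FG ∧ ∀ x ∈ V, ∀ l, h.proj l x ∈ N := by
  obtain ⟨t, rfl⟩ := hV
  have hfin (x : X) : (Set.range fun l => h.proj l x).Finite := by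
    refine (((h.finite_support_proj x).image fun l => h.proj l x).insert 0).subset ?_
    rintro _ ⟨l, rfl⟩
    by_cases hl : h.proj l x = 0
    · exact Or.inl hl
    · exact Or.inr (Set.mem_image_of_mem _ hl)
  refine ⟨Submodule.span _ (⋃ x ∈ t, Set.range fun l => h.proj l x),
    Submodule.fg_span (t.finite_toSet.biUnion fun x _ => hfin x), fun x hx => ?_⟩
  induction hx using Submodule.span_induction with
  | mem x hx =>
    exact fun l => Submodule.subset_span (Set.mem_biUnion hx (Set.mem_range_self l))
  | zero => exact fun l => by rw [map_zero]; exact zero_mem _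
  | add x y _ _ hx hy => exact fun l => by rw [map_add]; exact add_mem (hx l) (hy l)
  | smul f x _ hx => exact h.proj_smul_mem f hx

end IsGradedModule

end GradedModule

theorem Connection.d_compLeft_of_shift {k A B : Type*} [CommRing k] [CommRing A] [Algebra k A]
    [CommRing B] [Algebra k B] {n : ℕ} {δ : Fin n → Derivation k A A} {ε : Fin n → Derivation k B B}
    {N N' : Type*} [AddCommGroup N] [Module k N] [Module A N] [AddCommGroup N'] [Module k N']
    [Module B N'] (D : Connection δ N) (E : Connection ε N') {f g : N →ₗ[k] N'}
    (hfg : ∀ s m, g (D.op s m) = E.op s (f m)) (i : ℕ) (ω : Form n N i) :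
    E.d i (f.compLeft _ ω) = g.compLeft _ (D.d i ω) := by
  funext T
  simp only [Connection.d, LinearMap.coe_mk, AddHom.coe_mk, LinearMap.compLeft_apply,
    Function.comp_apply, map_sum, map_zsmul, hfg]

theorem Connection.mk_eq_zero_iff {k A : Type*} [CommRing k] [CommRing A] [Algebra k A] {n : ℕ}
    {δ : Fin n → Derivation k A A} {N : Type*} [AddCommGroup N] [Module k N] [Module A N]
    (D : Connection δ N) {i : ℕ} {ω : D.cocycles i} :
    (Submodule.Quotient.mk ω : D.Cohomology i) = 0 ↔ ω.1 ∈ D.coboundaries i :=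
  Submodule.Quotient.mk_eq_zero _

theorem finite_setOf_ne_zero {R V W ι : Type*} [Semiring R] [AddCommMonoid V] [Module R V]
    [AddCommMonoid W] [Module R W] [Module.Finite R V] {p : ι → V →ₗ[R] W}
    (hp : ∀ x, {i | p i x ≠ 0}.Finite) : {i | p i ≠ 0}.Finite := by
  obtain ⟨t, ht⟩ := Module.Finite.fg_top (R := R) (M := V)
  refine (t.finite_toSet.biUnion fun x _ => hp x).subset fun i hi => ?_
  by_contra hne
  simp only [Set.mem_iUnion, Set.mem_ofPred_eq, not_exists, not_not] at hne
  exact hi (LinearMap.ext_on ht fun x hx => hne x hx)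

section GradedDModule

variable {n : ℕ} {k : Type*} [Field k] {M : Type*} [AddCommGroup M] [Module k M]
  [Module (Poly n k) M] [Module (Diff n k) M] {𝓜 : ℤ → Submodule k M}

theorem IsGrading.isGradedModule (h : IsGrading n k 𝓜) : IsGradedModule (n := n) 𝓜 :=
  ⟨h.isInternal, h.smul_mem⟩

variable [IsScalarTower k (Poly n k) M] [IsScalarTower (Poly n k) (Diff n k) M]

variable (n 𝓜) in
/-- The degrees `l` with `Hⁱ_dR(M)_l ≠ 0`. -/
def cohomologyDegrees (i : ℕ) : Set ℤ :=
  {l | ∃ ω ∈ (conn n k M).cocycles i, (∀ S, ω S ∈ 𝓜 l) ∧ ω ∉ (conn n k M).coboundaries i}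

namespace IsGrading

variable (h : IsGrading n k 𝓜)
include h

theorem tensorComp_op (l : ℤ) (i : Fin n) (x : Completion n k M) :
    h.isGradedModule.tensorComp l ((completionConn n k M).op i x) =
      (conn n k M).op i (h.isGradedModule.tensorComp (l + 1) x) := by
  change h.isGradedModule.tensorComp l (completionOpAux n k M i x) = _
  induction x using TensorProduct.induction_on with
  | zero => simp only [map_zero]
  | add x y hx hy => simp only [map_add, hx, hy]
  | tmul s m =>
    induction m using h.isGradedModule.induction_on with
    | add x y hx hy => simp only [TensorProduct.tmul_add, map_add, hx, hy]
    | mem e m hm =>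
      have hop : (conn n k M).op i m ∈ 𝓜 (e - 1) := h.del_smul_mem i e m hm
      rw [completionOpAux_tmul, map_add, h.isGradedModule.tensorComp_tmul l _ hm,
        h.isGradedModule.tensorComp_tmul l _ hop, h.isGradedModule.tensorComp_tmul _ _ hm,
        (conn n k M).leibniz, homPart_pderiv, add_comm, sub_add_eq_add_sub, sub_sub_eq_add_sub]

theorem proj_op (l : ℤ) (i : Fin n) (m : M) :
    h.isGradedModule.proj l ((conn n k M).op i m) =
      (conn n k M).op i (h.isGradedModule.proj (l + 1) m) := by
  rw [← h.isGradedModule.tensorComp_kappa, kappa_op, h.tensorComp_op,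
    h.isGradedModule.tensorComp_kappa]

theorem d_tensorComp (l : ℤ) (i : ℕ) (ω : Form n (Completion n k M) i) :
    (conn n k M).d i ((h.isGradedModule.tensorComp (l + 1)).compLeft _ ω) =
      (h.isGradedModule.tensorComp l).compLeft _ ((completionConn n k M).d i ω) :=
  (completionConn n k M).d_compLeft_of_shift (conn n k M) (h.tensorComp_op l) i ω

theorem d_proj (l : ℤ) (i : ℕ) (ω : Form n M i) :
    (conn n k M).d i ((h.isGradedModule.proj (l + 1)).compLeft _ ω) =
      (h.isGradedModule.proj l).compLeft _ ((conn n k M).d i ω) :=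
  (conn n k M).d_compLeft_of_shift (conn n k M) (h.proj_op l) i ω

variable {i : ℕ}

theorem tensorComp_mem_cocycles {ω : Form n (Completion n k M) i}
    (hω : ω ∈ (completionConn n k M).cocycles i) (l : ℤ) :
    (h.isGradedModule.tensorComp l).compLeft _ ω ∈ (conn n k M).cocycles i := by
  have hd := h.d_tensorComp (l - 1) i ω
  rw [sub_add_cancel, LinearMap.mem_ker.1 hω, map_zero] at hd
  exact hd

theorem tensorComp_mem_coboundaries {ω : Form n (Completion n k M) i}
    (hω : ω ∈ (completionConn n k M).coboundaries i) (l : ℤ) :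
    (h.isGradedModule.tensorComp l).compLeft _ ω ∈ (conn n k M).coboundaries i := by
  cases i with
  | zero =>
    obtain rfl : ω = 0 := hω
    rw [map_zero]
    exact zero_mem _
  | succ i =>
    obtain ⟨η, rfl⟩ := hω
    exact ⟨_, h.d_tensorComp l i η⟩

theorem mem_coboundaries_of_kappa_mem {ω : Form n M i}
    (hω : (kappa n k M).compLeft _ ω ∈ (completionConn n k M).coboundaries i) :
    ω ∈ (conn n k M).coboundaries i := by
  rw [← h.isGradedModule.sum_proj_comp
    (h.isGradedModule.finite_support_proj_comp ω).coe_toFinset.superset]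
  refine sum_mem fun l _ => ?_
  rw [← h.isGradedModule.tensorComp_kappa_comp]
  exact h.tensorComp_mem_coboundaries hω l

theorem injective_kappaH (i : ℕ) : Function.Injective (kappaH n k M i) := by
  refine (injective_iff_map_eq_zero _).2 fun x hx => ?_
  obtain ⟨ω, rfl⟩ := Submodule.Quotient.mk_surjective _ x
  exact (conn n k M).mk_eq_zero_iff.2
    (h.mem_coboundaries_of_kappa_mem ((completionConn n k M).mk_eq_zero_iff.1 hx))

theorem exists_fg_primitives (hM : (conn n k M).FiniteType)
    {ω : Form n (Completion n k M) (i + 1)}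
    (hω : ∀ l, (h.isGradedModule.tensorComp l).compLeft _ ω ∈ LinearMap.range ((conn n k M).d i)) :
    ∃ P : Submodule (Poly n k) M, P.FG ∧ ∀ l, ∃ ζ : Form n M i,
      (∀ S, ζ S ∈ P ∧ ζ S ∈ 𝓜 (l + 1)) ∧
        (conn n k M).d i ζ = (h.isGradedModule.tensorComp l).compLeft _ ω := by
  obtain ⟨s, hs⟩ := hM.exists_fil
  choose Q hQ hωQ using fun S => h.isGradedModule.exists_fg_tensorComp_mem (ω S)
  obtain ⟨p, hp⟩ := (conn n k M).exists_le_fil hs (Submodule.fg_iSup Q hQ)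
  obtain ⟨q, hq⟩ := (conn n k M).exists_bounded_primitive hs i p
  obtain ⟨P, hP, hproj⟩ := h.isGradedModule.exists_fg_proj_mem
    ((conn n k M).fil_fg (g := ((↑) : s → M)) q)
  refine ⟨P, hP, fun l => ?_⟩
  obtain ⟨η, hη⟩ := hω l
  obtain ⟨η', hη', hd⟩ := hq η (mem_formsIn.2 fun S => by
    rw [hη]
    exact hp (Submodule.mem_iSup_of_mem S (hωQ S l)))
  refine ⟨(h.isGradedModule.proj (l + 1)).compLeft _ η',
    fun S => ⟨hproj _ (mem_formsIn.1 hη' S) _, h.isGradedModule.proj_mem _ _⟩, ?_⟩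
  rw [h.d_proj, hd, hη]
  funext S
  exact (h.isGradedModule.proj_of_mem (h.isGradedModule.tensorComp_mem l (ω S)) l).trans
    (if_pos rfl)

theorem mem_coboundaries_of_tensorComp_mem (hM : (conn n k M).FiniteType)
    {ω : Form n (Completion n k M) i}
    (hω : ∀ l, (h.isGradedModule.tensorComp l).compLeft _ ω ∈ (conn n k M).coboundaries i) :
    ω ∈ (completionConn n k M).coboundaries i := by
  cases i with
  | zero =>
    change ω = 0
    funext S
    refine h.isGradedModule.eq_of_tensorComp_eq fun l => ?_
    rw [Pi.zero_apply, map_zero]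
    exact congrFun (hω l) S
  | succ i =>
    obtain ⟨P, hP, hprim⟩ := h.exists_fg_primitives hM hω
    choose ζ hζ hdζ using hprim
    choose ξ hξ using fun S => h.isGradedModule.exists_tensorComp_eq hP
      (y := fun l => ζ (l - 1) S) (fun l => (hζ (l - 1) S).1)
      fun l => by simpa only [sub_add_cancel] using (hζ (l - 1) S).2
    have hcomp (l : ℤ) : (h.isGradedModule.tensorComp (l + 1)).compLeft _ ξ = ζ l :=
      funext fun S => (hξ S (l + 1)).trans (by rw [add_sub_cancel_right])
    refine ⟨ξ, funext fun T => h.isGradedModule.eq_of_tensorComp_eq fun l => ?_⟩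
    have hd := h.d_tensorComp l i ξ
    rw [hcomp, hdζ] at hd
    exact (congrFun hd T).symm

/-- The projection of `Hⁱ_dR(M)` onto its component of degree `l`. -/
def cohomologyProj (i : ℕ) (l : ℤ) : HdR n k M i →ₗ[k] HdR n k M i :=
  Submodule.mapQ _ _ (((h.isGradedModule.proj l).compLeft _).restrict
    fun ω hω => by
      rw [← h.isGradedModule.tensorComp_kappa_comp]
      exact h.tensorComp_mem_cocycles
        ((conn n k M).comp_mem_cocycles _ (kappa n k M) (kappa_op n k M) i ω hω) l)
    fun ω hω => by
      change (h.isGradedModule.proj l).compLeft _ ω.1 ∈ (conn n k M).coboundaries i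
      rw [← h.isGradedModule.tensorComp_kappa_comp]
      exact h.tensorComp_mem_coboundaries
        ((conn n k M).comp_mem_coboundaries _ (kappa n k M) (kappa_op n k M) i ω.1 hω) l

theorem finite_cohomologyDegrees (i : ℕ) [FiniteDimensional k (HdR n k M i)] :
    (cohomologyDegrees n 𝓜 i).Finite := by
  have hfin (x : HdR n k M i) : {l | h.cohomologyProj i l x ≠ 0}.Finite := by
    obtain ⟨ω, rfl⟩ := Submodule.Quotient.mk_surjective _ x
    refine (h.isGradedModule.finite_support_proj_comp ω.1).subset fun l hl h0 => hl ?_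
    refine (conn n k M).mk_eq_zero_iff.2 ?_
    change (h.isGradedModule.proj l).compLeft _ ω.1 ∈ _
    rw [h0]
    exact zero_mem _
  refine (finite_setOf_ne_zero hfin).subset ?_
  rintro l ⟨ω, hω, hωl, hnot⟩ h0
  refine hnot ?_
  have hproj : (h.isGradedModule.proj l).compLeft _ ω = ω :=
    funext fun S => (h.isGradedModule.proj_of_mem (hωl S) l).trans (if_pos rfl)
  rw [← hproj]
  exact (conn n k M).mk_eq_zero_iff.1
    (LinearMap.congr_fun h0 (Submodule.Quotient.mk ⟨ω, hω⟩))

theorem surjective_kappaH (hM : (conn n k M).FiniteType) (hfin : (cohomologyDegrees n 𝓜 i).Finite) :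
    Function.Surjective (kappaH n k M i) := by
  intro x
  obtain ⟨⟨ω, hω⟩, rfl⟩ := Submodule.Quotient.mk_surjective _ x
  let c (l : ℤ) : (conn n k M).cocycles i := ⟨_, h.tensorComp_mem_cocycles hω l⟩
  let θ : (conn n k M).cocycles i := ∑ l ∈ hfin.toFinset, c l
  refine ⟨Submodule.Quotient.mk θ, (Submodule.Quotient.eq _).2 ?_⟩
  refine h.mem_coboundaries_of_tensorComp_mem hM fun l => ?_
  change (h.isGradedModule.tensorComp l).compLeft _ ((kappa n k M).compLeft _ θ.1 - ω) ∈ _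
  have hθ : (h.isGradedModule.proj l).compLeft _ θ.1 =
      if l ∈ hfin.toFinset then (c l).1 else 0 := by
    rw [AddSubmonoidClass.coe_finsetSum, map_sum,
      ← Finset.sum_ite_eq' hfin.toFinset l fun e => (c e).1]
    refine Finset.sum_congr rfl fun e _ => funext fun S => ?_
    rw [ite_apply]
    exact h.isGradedModule.proj_of_mem (h.isGradedModule.tensorComp_mem e (ω S)) l
  rw [map_sub, h.isGradedModule.tensorComp_kappa_comp, hθ]
  split_ifs with hl
  · rw [sub_self]
    exact zero_mem _
  · rw [zero_sub, neg_mem_iff]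
    by_contra hnot
    exact hl (hfin.mem_toFinset.2
      ⟨_, (c l).2, fun S => h.isGradedModule.tensorComp_mem l (ω S), hnot⟩)

end IsGrading

end GradedDModule

end DMod

end

theorem theoremA_general (n : ℕ) (k : Type*) [Field k]
    (M : Type*) [AddCommGroup M] [Module k M] [Module (DMod.Poly n k) M]
    [IsScalarTower k (DMod.Poly n k) M]
    [Module (DMod.Diff n k) M] [IsScalarTower (DMod.Poly n k) (DMod.Diff n k) M]
    (𝓜 : ℤ → Submodule k M) (h𝓜 : DMod.IsGrading n k 𝓜) (i : ℕ) :
    Function.Injective (DMod.kappaH n k M i) ∧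
      ((DMod.conn n k M).FiniteType → (DMod.cohomologyDegrees n 𝓜 i).Finite →
        Function.Bijective (DMod.kappaH n k M i)) :=
  ⟨h𝓜.injective_kappaH i, fun hM hfin => ⟨h𝓜.injective_kappaH i, h𝓜.surjective_kappaH hM hfin⟩⟩

theorem theoremA (n : ℕ) (k : Type*) [Field k] [CharZero k]
    (M : Type*) [AddCommGroup M] [Module k M] [Module (DMod.Poly n k) M]
    [IsScalarTower k (DMod.Poly n k) M]
    [Module (DMod.Diff n k) M] [IsScalarTower (DMod.Poly n k) (DMod.Diff n k) M]
    [Module.Finite (DMod.Diff n k) M]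
    (𝓜 : ℤ → Submodule k M) (h𝓜 : DMod.IsGrading n k 𝓜) (i : ℕ) :
    Function.Injective (DMod.kappaH n k M i) ∧
      (FiniteDimensional k (DMod.HdR n k M i) → Function.Bijective (DMod.kappaH n k M i)) := by
  have hgen := theoremA_general n k M 𝓜 h𝓜 i
  exact ⟨hgen.1, fun _ => hgen.2 (DMod.conn_finiteType n k M) (h𝓜.finite_cohomologyDegrees i)⟩
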